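/- Let $r\ge 0$, $n_k\ge 1$, $m_k\ge 0$ $(k=1,\dots,r)$ and $N\ge 1$ be integers, $\mathbb V=\mathbb R^{n_1\times\cdots\times n_r}$ and $\mathbb U=\mathbb R^{m_1\times\cdots\times m_r}$ with the Frobenius inner product, $n=\dim\mathbb V=\prod_k n_k$ and $m=\dim\mathbb U=\prod_k m_k$. For $\boldsymbol A=(A_1,\dots,A_r)$ with $A_k\in\mathbb R^{n_k\times m_k}$, let $F_{\boldsymbol A}:\mathbb U\to\mathbb V$ be the Tucker map $(F_{\boldsymbol A}T)_{i_1\dots i_r}=\sum_{j_1,\dots,j_r}(A_1)_{i_1j_1}\cdots(A_r)_{i_rj_r}T_{j_1\dots j_r}$, and $F_{\boldsymbol A}^*$ its adjoint. The parameters are $\theta=(\boldsymbol A,\nu,\sigma^2)$ with $\nu\in\mathbb U$ and $\sigma^2>0$; put $\mu=F_{\boldsymbol A}\nu$. In the tensor probabilistic PCA (TPCA) model with parameter $\theta$, $X=\mu+F_{\boldsymbol A}Z+\varepsilon$, where $Z\sim N(0,\mathbb I_{\mathbb U})$ and $\varepsilon\sim N(0,\sigma^2\mathbb I_{\mathbb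 V})$ are independent. Let $$p_\theta(x,z)=(2\pi)^{-m/2}e^{-\|z\|^2/2}\,(2\pi\sigma^2)^{-n/2}e^{-\|x-\mu-F_{\boldsymbol A}z\|^2/(2\sigma^2)}$$ and let $p_\theta(z\mid x)=p_\theta(x,z)/\int p_\theta(x,z')\,dz'$. For data $x^{(1)},\dots,x^{(N)}\in\mathbb V$, the EM algorithm passes from $\theta_0$ to a maximizer $\theta$, over all parameters, of $$Q(\theta\mid\theta_0)=\sum_{i=1}^N\int\log p_\theta(x^{(i)},z)\,p_{\theta_0}(z\mid x^{(i)})\,dz .$$ Given $\theta_0=(\boldsymbol A_0,\nu_0,\sigma_0^2)$ and $\mu_0=F_{\boldsymbol A_0}\nu_0$, let $M_0=F_{\boldsymbol A_0}^*F_{\boldsymbol A_0}+\sigma_0^2\mathbb I_{\mathbb U}$ and $$E_i=M_0^{-1}F_{\boldsymbol A_0}^*(x^{(i)}-\mu_0),\qquad V=\sigma_0^2M_0^{-1},\tag{E1, E2}$$ $$G(\boldsymbol A,\mu)=\tfrac1N\sum_{i=1}^N\|x^{(i)}-\mu-F_{\boldsymbol A}E_i\|^2+\operatorname{tr}(F_{\boldsymbol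 A}VF_{\boldsymbol A}^*).\tag{M}$$ The procedure passes from $\theta_0$ to $\theta=(\boldsymbol A,\nu,\sigma^2)$, with $\sigma^2>0$, as follows. First, $\boldsymbol A$ is the factor part of a minimizer of $G(\boldsymbol A,\mu)$ over all $(\boldsymbol A,\mu)$ with $\mu\in\operatorname{Im}F_{\boldsymbol A}$. Then $$\nu=(F_{\boldsymbol A}^*F_{\boldsymbol A})^{-1}F_{\boldsymbol A}^*\Bigl(\tfrac1N\sum_{i=1}^N(x^{(i)}-F_{\boldsymbol A}E_i)\Bigr)\tag{N}$$ (if $F_{\boldsymbol A}^*F_{\boldsymbol A}$ is singular, $\nu$ is instead any minimizer of $\nu\mapsto G(\boldsymbol A,F_{\boldsymbol A}\nu)$). Finally, with $\mu=F_{\boldsymbol A}\nu$, $$\sigma^2=\tfrac1{nN}\sum_{i=1}^N\|x^{(i)}-\mu-F_{\boldsymbol A}E_i\|^2+\tfrac1n\operatorname{tr}(F_{\boldsymbol A}VF_{\boldsymbol A}^*).\tag{M2}$$ Theorem. (1) Let $(X^{(i)},Z^{(i)})_{i\le N}$ be independent draws from the TPCA model with parameter $\theta_0$. Then each $(X^{(i)},Z^{(i)})$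 has Lebesgue density $p_{\theta_0}$, and almost surely $\mathbb E(Z^{(i)}\mid X^{(i)})=M_0^{-1}F_{\boldsymbol A_0}^*(X^{(i)}-\mu_0)$ and $\operatorname{Var}(Z^{(i)}\mid X^{(i)})=\sigma_0^2M_0^{-1}$. For every $\theta$ the complete-data log-likelihood $\ell(\theta)=\sum_i\log p_\theta(X^{(i)},Z^{(i)})$ is integrable, and almost surely $\mathbb E(\ell(\theta)\mid X^{(1)},\dots,X^{(N)})=Q(\theta\mid\theta_0)$, where $Q$ is evaluated at the data $X^{(1)},\dots,X^{(N)}$. (2) For all data and all $\theta_0$: $M_0$ is invertible; $p_{\theta_0}(\cdot\mid x^{(i)})$ is a probability density with mean $E_i$ and covariance $V$; the integrals defining $Q$ converge, and for every $\theta$ $$Q(\theta\mid\theta_0)=-\tfrac{N(n+m)}2\log(2\pi)-\tfrac12\sum_i\|E_i\|^2-\tfrac{nN}2\log\sigma^2-\tfrac1{2\sigma^2}\sum_i\|x^{(i)}-\mu-F_{\boldsymbol A}E_i\|^2-\tfrac N2\operatorname{tr}V-\tfrac N{2\sigma^2}\operatorname{tr}(F_{\boldsymbol A}VF_{\boldsymbol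 A}^*).$$ (3) For all data and all $\theta_0$: for fixed $\sigma^2>0$, $Q(\boldsymbol A',\nu',\sigma^2\mid\theta_0)\le Q(\boldsymbol A,\nu,\sigma^2\mid\theta_0)$ if and only if $G(\boldsymbol A,F_{\boldsymbol A}\nu)\le G(\boldsymbol A',F_{\boldsymbol A'}\nu')$. For fixed $\sigma^2>0$ and fixed $\boldsymbol A$ with $F_{\boldsymbol A}^*F_{\boldsymbol A}$ invertible, the unique maximizer of $Q$ in $\nu$ is (N). For fixed $\boldsymbol A,\nu$, a number $\sigma^2>0$ maximizes $Q$ over $(0,\infty)$ if and only if it is given by (M2). (4) The procedure is exactly the EM algorithm: for all data and all parameters $\theta_0,\theta$, the procedure can pass from $\theta_0$ to $\theta$ if and only if $\theta$ maximizes $Q(\cdot\mid\theta_0)$ over all parameters; hence a sequence of parameters is a run of the procedure if and only if it is a run of the EM algorithm. -/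

import Mathlib

namespace TPCA

open MeasureTheory ProbabilityTheory

noncomputable section

/-- Real tensors of format `n 0 × ⋯ × n (r-1)`, with the standard (Frobenius) inner product. -/
abbrev Tensor {r : ℕ} (n : Fin r → ℕ) : Type := EuclideanSpace ℝ (∀ k, Fin (n k))

/-- A family of factor matrices `A k`, of size `n k × m k`. -/
abbrev Factors {r : ℕ} (n m : Fin r → ℕ) : Type := ∀ k, Matrix (Fin (n k)) (Fin (m k)) ℝ

/-- The dimension of the tensor space, as a real number. -/
def dim {r : ℕ} (n : Fin r → ℕ) : ℝ := ((∏ k, n k : ℕ) : ℝ)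

variable {r : ℕ} {n m : Fin r → ℕ}

/-- The Tucker map `T ↦ A · T`. -/
def tucker (A : Factors n m) : Tensor m →ₗ[ℝ] Tensor n :=
  Matrix.toEuclideanLin (Matrix.of fun i j => ∏ k, A k (i k) (j k))

theorem tucker_apply (A : Factors n m) (T : Tensor m) (i : ∀ k, Fin (n k)) :
    tucker A T i = ∑ j : (∀ k, Fin (m k)), (∏ k, A k (i k) (j k)) * T j := by
  simp [tucker, Matrix.toLpLin_apply, Matrix.mulVec, dotProduct]

/-- The adjoint of the Tucker map. -/
abbrev tuckerAdj (A : Factors n m) : Tensor n →ₗ[ℝ] Tensor m := LinearMap.adjoint (tucker A)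

/-- The parameters `θ = (A, ν, σ²)` with `σ² > 0`. -/
structure Params {r : ℕ} (n m : Fin r → ℕ) where
  A : Factors n m
  nu : Tensor m
  sigmaSq : ℝ
  sigmaSq_pos : 0 < sigmaSq

/-- The mean `μ = A · ν`. -/
def Params.mu (θ : Params n m) : Tensor n := tucker θ.A θ.nu

/-! ### The model -/

/-- `Y` is a normal random tensor with mean `μ` and covariance operator `C`: every `⟨Y, T⟩` is
normal with mean `⟨μ, T⟩` and variance `⟨C T, T⟩`. -/
def IsNormalTensor {Ω : Type*} [MeasurableSpace Ω] (P : Measure Ω) (Y : Ω → Tensor n)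
    (μ : Tensor n) (C : Module.End ℝ (Tensor n)) : Prop :=
  Measurable Y ∧ ∀ T : Tensor n,
    P.map (fun ω => inner ℝ (Y ω) T) = gaussianReal (inner ℝ μ T) (inner ℝ (C T) T).toNNReal

/-- `X = A · ν + A · Z + ε`, with `Z` standard normal, `ε ∼ N(0, σ² I)`, and `Z`, `ε`
independent. -/
def IsTPCA {Ω : Type*} [MeasurableSpace Ω] (P : Measure Ω) (θ : Params n m)
    (X : Ω → Tensor n) (Z : Ω → Tensor m) : Prop :=
  ∃ ε : Ω → Tensor n,
    IsNormalTensor P Z 0 LinearMap.id ∧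
    IsNormalTensor P ε 0 (θ.sigmaSq • LinearMap.id) ∧
    IndepFun Z ε P ∧
    ∀ ω, X ω = θ.mu + tucker θ.A (Z ω) + ε ω

/-- `(X i, Z i)`, `i < N`, are independent draws of the complete data. -/
def IsTPCASample {Ω : Type*} [MeasurableSpace Ω] (P : Measure Ω) (θ : Params n m) {N : ℕ}
    (X : Fin N → Ω → Tensor n) (Z : Fin N → Ω → Tensor m) : Prop :=
  (∀ i, IsTPCA P θ (X i) (Z i)) ∧ iIndepFun (fun i ω => (X i ω, Z i ω)) P

/-! ### The EM algorithm for the model -/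

/-- The Lebesgue density at `x` of the isotropic normal law `N(μ, v I)`. -/
def normalDensity (v : ℝ) (μ x : Tensor n) : ℝ :=
  (2 * Real.pi * v) ^ (-(dim n / 2)) * Real.exp (-(‖x - μ‖ ^ 2 / (2 * v)))

/-- The complete-data density `p_θ(x, z) = p(z) p_θ(x | z)`. -/
def jointDensity (θ : Params n m) (x : Tensor n) (z : Tensor m) : ℝ :=
  normalDensity 1 0 z * normalDensity θ.sigmaSq (θ.mu + tucker θ.A z) x

/-- The conditional law of the latent tensor given `X = x`, with the density
`z ↦ p_θ(x, z) / ∫ p_θ(x, z') dz'`. -/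
def latentPosterior (θ : Params n m) (x : Tensor n) : Measure (Tensor m) :=
  volume.withDensity fun z =>
    ENNReal.ofReal (jointDensity θ x z / ∫ z', jointDensity θ x z')

/-- The complete-data log-likelihood. -/
def logLik {N : ℕ} (θ : Params n m) (x : Fin N → Tensor n) (z : Fin N → Tensor m) : ℝ :=
  ∑ i, Real.log (jointDensity θ (x i) (z i))

/-- The EM objective `Q(θ | θ₀) = E_{θ₀}(ℓ(θ) | data)`: the conditional expectation of the
complete-data log-likelihood at `θ`, under the parameter `θ₀`. -/
def emQ {N : ℕ} (x : Fin N → Tensor n) (θ₀ θ : Params n m) : ℝ :=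
  ∑ i, ∫ z, Real.log (jointDensity θ (x i) z) ∂(latentPosterior θ₀ (x i))

/-- `θ` is an EM update of `θ₀`: it maximizes `Q(· | θ₀)` over all parameters. -/
def IsEMStep {N : ℕ} (x : Fin N → Tensor n) (θ₀ θ : Params n m) : Prop :=
  ∀ θ' : Params n m, emQ x θ₀ θ' ≤ emQ x θ₀ θ

/-! ### The explicit procedure -/

/-- `M = F_A* F_A + σ² I`. -/
def opM (θ : Params n m) : Module.End ℝ (Tensor m) :=
  tuckerAdj θ.A ∘ₗ tucker θ.A + θ.sigmaSq • LinearMap.id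

/-- `E = M⁻¹ F_A* (x - μ)`. -/
def eMean (θ : Params n m) (x : Tensor n) : Tensor m :=
  Ring.inverse (opM θ) (tuckerAdj θ.A (x - θ.mu))

/-- `V = σ² M⁻¹`. -/
def eCov (θ : Params n m) : Module.End ℝ (Tensor m) :=
  θ.sigmaSq • Ring.inverse (opM θ)

/-- The residual sum of squares `∑ i, ‖X i - μ - F_A (E i)‖²`. -/
def rss {N : ℕ} (x : Fin N → Tensor n) (E : Fin N → Tensor m)
    (A : Factors n m) (μ : Tensor n) : ℝ :=
  ∑ i, ‖x i - μ - tucker A (E i)‖ ^ 2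

/-- `tr (F_A V F_A*)`. -/
def traceTerm (V : Module.End ℝ (Tensor m)) (A : Factors n m) : ℝ :=
  LinearMap.trace ℝ (Tensor n) (tucker A ∘ₗ V ∘ₗ tuckerAdj A)

/-- The M-step objective `N⁻¹ ∑ i, ‖X i - μ - F_A (E i)‖² + tr (F_A V F_A*)`, with
`E` and `V` computed from `θ₀`. -/
def mObjective {N : ℕ} (x : Fin N → Tensor n) (θ₀ : Params n m)
    (A : Factors n m) (μ : Tensor n) : ℝ :=
  1 / (N : ℝ) * rss x (fun i => eMean θ₀ (x i)) A μ + traceTerm (eCov θ₀) A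

/-- `F_A* F_A`. -/
def gram (A : Factors n m) : Module.End ℝ (Tensor m) := tuckerAdj A ∘ₗ tucker A

/-- `ν = (F_A* F_A)⁻¹ F_A* (N⁻¹ ∑ i, (X i - F_A (E i)))`. -/
def nuUpdate {N : ℕ} (x : Fin N → Tensor n) (θ₀ : Params n m) (A : Factors n m) : Tensor m :=
  Ring.inverse (gram A)
    (tuckerAdj A ((1 / (N : ℝ)) • ∑ i, (x i - tucker A (eMean θ₀ (x i)))))

/-- `σ² = (n N)⁻¹ ∑ i, ‖X i - μ - F_A (E i)‖² + n⁻¹ tr (F_A V F_A*)`. -/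
def sigmaSqUpdate {N : ℕ} (x : Fin N → Tensor n) (θ₀ : Params n m)
    (A : Factors n m) (μ : Tensor n) : ℝ :=
  1 / (dim n * N) * rss x (fun i => eMean θ₀ (x i)) A μ
    + 1 / dim n * traceTerm (eCov θ₀) A

/-- One round of the procedure, from `θ₀` to `θ`. First `A` comes from minimizing the M-step
objective over all `(A, μ)` with `μ = A · ν`; then `ν` is given by its formula (if `F_A* F_A` is
singular, so that the formula is not defined, `ν` is any minimizer of the objective for this `A`);
finally `σ²` is given by its formula. -/
def IsProcedureStep {N : ℕ} (x : Fin N → Tensor n) (θ₀ θ : Params n m) : Prop :=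
  (∃ ν : Tensor m, ∀ (A' : Factors n m) (ν' : Tensor m),
    mObjective x θ₀ θ.A (tucker θ.A ν) ≤ mObjective x θ₀ A' (tucker A' ν')) ∧
  (IsUnit (gram θ.A) → θ.nu = nuUpdate x θ₀ θ.A) ∧
  (¬ IsUnit (gram θ.A) → ∀ ν' : Tensor m,
    mObjective x θ₀ θ.A (tucker θ.A θ.nu) ≤ mObjective x θ₀ θ.A (tucker θ.A ν')) ∧
  θ.sigmaSq = sigmaSqUpdate x θ₀ θ.A θ.mu

end

end TPCA

open MeasureTheory ProbabilityTheory TPCA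

namespace TPCA

noncomputable section

variable {r : ℕ} {n m : Fin r → ℕ}

/-! ### General measure theory -/

/-! The E-step rests on completing the square in `z`. Since `M E(x) = F*(x - μ)`, the joint density
factors as `p(x, E(x)) · exp(-⟨M w, w⟩ / 2σ²)` with `w = z - E(x)` (`jointDensity_add_eMean`). The
shear `(x, z) ↦ (x, z - E(x))` preserves Lebesgue measure, so the residual `W = Z - E(X)` is
independent of `X` with a law that does not involve `x` (`IsTPCA.map_obs_residual`), and the
posterior at any `x` is that law translated by `E(x)` (`latentPosterior_eq_map`). Every conditional
statement becomes an integral against the residual law.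

The moments of that law need no Gaussian integral with matrix coefficient: in the model itself `W =
M⁻¹(σ² Z - F* ε)` is linear in the independent pair `(Z, ε)`, so its mean is `0` and its covariance
is `σ² M⁻¹` (`IsTPCA.integral_inner_residual_mul`). As `log p_θ` is quadratic in `z`, mean and
covariance determine `Q`.

For the M-step, `Q(θ | θ₀) = const - (N/2)(n log σ² + G(A, μ)/σ²)` (`emQ_eq_mObjective`). For every
`σ²` the best `(A, ν)` are the minimizers of `G`, whatever `σ²` is. For fixed `A`, `G` is a
least-squares problem in `ν`, solved by the normal equations (`mObjective_eq_add`); for fixed `(A,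
ν)`, `n log s + G/s` is minimal exactly at `s = G/n` (`forall_log_add_div_le_iff`). Hence optimizing
successively is the same as optimizing jointly. -/

theorem map_withDensity_comp {α β : Type*} [MeasurableSpace α] [MeasurableSpace β]
    {a : Measure α} {b : Measure β} {Φ : α → β} (hΦ : MeasurePreserving Φ a b)
    {f : β → ENNReal} (hf : Measurable f) :
    (a.withDensity fun x => f (Φ x)).map Φ = b.withDensity f := by
  ext s hs
  rw [Measure.map_apply hΦ.measurable hs, withDensity_apply _ (hΦ.measurable hs),
    withDensity_apply _ hs, hΦ.setLIntegral_comp_preimage hs hf]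

/-- If `W` is independent of `Y`, conditioning `f (Y, W)` on `Y` integrates out `W`. -/
theorem condExp_of_indepFun {Ω α β : Type*} [MeasurableSpace Ω] {P : Measure Ω}
    [IsProbabilityMeasure P] [mα : MeasurableSpace α] [MeasurableSpace β] [StandardBorelSpace β]
    [Nonempty β] {Y : Ω → α} {W : Ω → β} (hY : Measurable Y) (hW : Measurable W)
    (h : IndepFun Y W P) {f : α × β → ℝ} (hf : Measurable f)
    (hi : Integrable (fun ω => f (Y ω, W ω)) P) :
    P[fun ω => f (Y ω, W ω) | mα.comap Y] =ᵐ[P] fun ω => ∫ w, f (Y ω, w) ∂(P.map W) := by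
  have h1 := condExp_prod_ae_eq_integral_condDistrib hY hW.aemeasurable hf.stronglyMeasurable hi
  have := Measure.isProbabilityMeasure_map (μ := P) hW.aemeasurable
  -- Independence means that the joint law is a product, so the conditional distribution of `W`
  -- given `Y` is the constant kernel.
  have h2 : condDistrib W Y P =ᵐ[P.map Y] Kernel.const α (P.map W) := by
    refine condDistrib_ae_eq_of_measure_eq_compProd Y hW.aemeasurable ?_
    rw [Measure.compProd_const]
    exact (indepFun_iff_map_prod_eq_prod_map_map hY.aemeasurable hW.aemeasurable).1 h
  have h3 := ae_of_ae_map hY.aemeasurable h2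
  filter_upwards [h1, h3] with ω e1 e3
  rw [e1, e3, Kernel.const_apply]

/-- If the pairs `(X i, W i)` are independent and `X i`, `W i` are independent, then `W i` is
independent of the whole family `X`. -/
theorem indepFun_pi_of_iIndepFun_prodMk {Ω ι α β : Type*} [Fintype ι] [MeasurableSpace Ω]
    {P : Measure Ω} [IsProbabilityMeasure P] [MeasurableSpace α] [MeasurableSpace β]
    {X : ι → Ω → α} {W : ι → Ω → β} (hX : ∀ i, Measurable (X i)) (hW : ∀ i, Measurable (W i))
    (h : iIndepFun (fun i ω => (X i ω, W i ω)) P) (i : ι) (hi : IndepFun (X i) (W i) P) :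
    IndepFun (fun ω j => X j ω) (W i) P := by
  classical
  have hXi : iIndepFun X P := h.comp (fun _ p => p.1) fun _ => measurable_fst
  have hXm : Measurable fun ω j => X j ω := measurable_pi_lambda _ hX
  rw [indepFun_iff_map_prod_eq_prod_map_map hXm.aemeasurable (hW i).aemeasurable]
  have := Measure.isProbabilityMeasure_map (μ := P) (hW i).aemeasurable
  have := Measure.isProbabilityMeasure_map (μ := P) hXm.aemeasurable
  have : ∀ j, IsProbabilityMeasure (P.map (X j)) := fun j =>
    Measure.isProbabilityMeasure_map (hX j).aemeasurable
  -- It suffices to compare the two measures on the π-system of sets `(∏ B j) × A`.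
  refine (Measure.prod_eq_generateFrom generateFrom_pi
    MeasurableSpace.generateFrom_measurableSet isPiSystem_pi
    MeasurableSpace.isPiSystem_measurableSet ?_ ?_ ?_).symm
  · exact ⟨fun _ => Set.univ, fun _ => ⟨fun _ => Set.univ, by simp, by simp⟩, by simp,
      by simp [Set.iUnion_const]⟩
  · exact ⟨fun _ => Set.univ, by simp, by simp, by simp [Set.iUnion_const]⟩
  · rintro _ ⟨B, hB, rfl⟩ A hA
    have hB' : ∀ j, MeasurableSet (B j) := fun j => hB j (Set.mem_univ j)
    rw [Measure.map_apply (hXm.prodMk (hW i)) ((MeasurableSet.univ_pi hB').prod hA),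
      hXi.map_fun_eq_pi_map (fun j => (hX j).aemeasurable), Measure.pi_pi]
    -- The constraint `A` on `W i` is put into the `i`-th pair and the other pairs carry none, so
    -- independence of the pairs factors the event.
    have e := h.measure_inter_preimage_eq_mul Finset.univ
      (sets := fun j => B j ×ˢ (if j = i then A else Set.univ)) (fun j _ =>
        (hB' j).prod (by
          by_cases hj : j = i
          · rw [if_pos hj]; exact hA
          · rw [if_neg hj]; exact MeasurableSet.univ))
    have e1 : (fun ω => (fun j => X j ω, W i ω)) ⁻¹' (Set.univ.pi B ×ˢ A) =
        ⋂ j ∈ Finset.univ, (fun ω => (X j ω, W j ω)) ⁻¹'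
          (B j ×ˢ (if j = i then A else Set.univ)) := by
      ext ω
      simp only [Set.mem_preimage, Set.mem_prod, Set.mem_pi, Set.mem_iInter, Finset.mem_univ,
        Set.mem_univ, true_implies]
      constructor
      · rintro ⟨h1, h2⟩ j
        refine ⟨h1 j, ?_⟩
        by_cases hj : j = i
        · subst hj; simpa using h2
        · simp [hj]
      · intro h1
        exact ⟨fun j => (h1 j).1, by simpa using (h1 i).2⟩
    rw [e1, e, ← Finset.mul_prod_erase _ _ (Finset.mem_univ i),
      ← Finset.mul_prod_erase _ (fun j => (P.map (X j)) (B j)) (Finset.mem_univ i)]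
    have e2 : P ((fun ω => (X i ω, W i ω)) ⁻¹' (B i ×ˢ (if i = i then A else Set.univ))) =
        P.map (X i) (B i) * P.map (W i) A := by
      rw [Measure.map_apply (hX i) (hB' i), Measure.map_apply (hW i) hA,
        ← hi.measure_inter_preimage_eq_mul _ _ (hB' i) hA]
      simp [Set.mk_preimage_prod]
    rw [e2, mul_right_comm]
    congr 2
    refine Finset.prod_congr rfl fun j hj => ?_
    have hj' : j ≠ i := (Finset.mem_erase.1 hj).1
    rw [Measure.map_apply (hX j) (hB' j)]
    simp [hj', Set.mk_preimage_prod]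

/-! ### Isotropic normal densities -/

theorem dim_eq_card (n : Fin r → ℕ) : dim n = (Fintype.card (∀ k, Fin (n k)) : ℝ) := by
  simp [dim]

theorem normalDensity_pos {v : ℝ} (hv : 0 < v) (μ x : Tensor n) : 0 < normalDensity v μ x := by
  unfold normalDensity; positivity

theorem log_normalDensity {v : ℝ} (hv : 0 < v) (μ x : Tensor n) :
    Real.log (normalDensity v μ x) =
      -(dim n / 2) * (Real.log (2 * Real.pi) + Real.log v) - ‖x - μ‖ ^ 2 / (2 * v) := by
  unfold normalDensity
  rw [Real.log_mul (by positivity) (by positivity), Real.log_exp, Real.log_rpow (by positivity),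
    Real.log_mul (by positivity) hv.ne']
  ring

/-- The normal law `N(0, v I)`, given by its density. -/
def isoNormal (n : Fin r → ℕ) (v : ℝ) : Measure (Tensor n) :=
  volume.withDensity fun x => ENNReal.ofReal (normalDensity v 0 x)

/-- A Gaussian Fourier integral with quadratic coefficient `1 / (2v)` and linear coefficient `I`. It
serves twice: `t = 0` gives total mass one, general `t` the characteristic function. -/
theorem integral_isoNormal {v : ℝ} (hv : 0 < v) (t : Tensor n) :
    ∫ x, Complex.exp (inner ℝ x t * Complex.I) ∂(isoNormal n v) =
      Complex.exp (-(v * ‖t‖ ^ 2 / 2)) := by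
  have hm : Measurable fun x : Tensor n => ENNReal.ofReal (normalDensity v 0 x) := by
    unfold normalDensity; fun_prop
  rw [isoNormal, integral_withDensity_eq_integral_toReal_smul hm (by simp)]
  have hb : 0 < ((1 / (2 * v) : ℝ) : ℂ).re := by rw [Complex.ofReal_re]; positivity
  have key := GaussianFourier.integral_cexp_neg_mul_sq_norm_add hb Complex.I t
  have e1 : ∀ x : Tensor n, (ENNReal.ofReal (normalDensity v 0 x)).toReal •
      Complex.exp (inner ℝ x t * Complex.I) =
      (((2 * Real.pi * v) ^ (-(dim n / 2)) : ℝ) : ℂ) *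
        Complex.exp (-((1 / (2 * v) : ℝ) : ℂ) * ‖x‖ ^ 2 + Complex.I * inner ℝ t x) := by
    intro x
    rw [ENNReal.toReal_ofReal (normalDensity_pos hv _ _).le, normalDensity, Complex.real_smul,
      Complex.exp_add, sub_zero, real_inner_comm]
    push_cast
    rw [mul_assoc]
    congr 3
    · ring
    · ring
  simp_rw [e1]
  rw [integral_const_mul, key, ← mul_assoc]
  have e2 : (((2 * Real.pi * v) ^ (-(dim n / 2)) : ℝ) : ℂ) *
      (Real.pi / ((1 / (2 * v) : ℝ) : ℂ)) ^ (Module.finrank ℝ (Tensor n) / 2 : ℂ) = 1 := by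
    have : (Real.pi / ((1 / (2 * v) : ℝ) : ℂ)) ^ (Module.finrank ℝ (Tensor n) / 2 : ℂ) =
        (((2 * Real.pi * v) ^ (dim n / 2) : ℝ) : ℂ) := by
      rw [Complex.ofReal_cpow (by positivity), finrank_euclideanSpace, dim_eq_card]
      congr 1
      · push_cast; field_simp
      · push_cast; rfl
    rw [this, ← Complex.ofReal_mul, ← Real.rpow_add (by positivity)]
    simp
  rw [e2, one_mul]
  congr 1
  push_cast
  have : (v : ℂ) ≠ 0 := by exact_mod_cast hv.ne'
  field_simp
  rw [Complex.I_sq]; ring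

theorem isProbabilityMeasure_isoNormal {v : ℝ} (hv : 0 < v) :
    IsProbabilityMeasure (isoNormal n v) := by
  have h := integral_isoNormal (n := n) hv 0
  simp only [inner_zero_right, Complex.ofReal_zero, zero_mul, Complex.exp_zero, norm_zero] at h
  simp only [integral_const, ne_eq, OfNat.ofNat_ne_zero, not_false_eq_true, zero_pow,
    mul_zero, zero_div, neg_zero, Complex.exp_zero, Complex.real_smul, mul_one] at h
  constructor
  have h' : (isoNormal n v).real Set.univ = 1 := by exact_mod_cast h
  rwa [measureReal_def, ENNReal.toReal_eq_one_iff] at h'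

theorem charFun_isoNormal {v : ℝ} (hv : 0 < v) (t : Tensor n) :
    charFun (isoNormal n v) t = Complex.exp (-(v * ‖t‖ ^ 2 / 2)) := by
  rw [charFun_apply, integral_isoNormal hv]

theorem inner_smul_id (v : ℝ) (T : Tensor n) :
    inner ℝ ((v • LinearMap.id : Module.End ℝ (Tensor n)) T) T = v * ‖T‖ ^ 2 := by
  simp [inner_smul_left]

/-- The defining property of a centred isotropic normal tensor determines its density. -/
theorem IsNormalTensor.map_eq {Ω : Type*} [MeasurableSpace Ω] {P : Measure Ω}
    [IsProbabilityMeasure P] {Y : Ω → Tensor n} {v : ℝ} (hv : 0 < v)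
    (h : IsNormalTensor P Y 0 (v • LinearMap.id)) : P.map Y = isoNormal n v := by
  have := isProbabilityMeasure_isoNormal (n := n) hv
  have := Measure.isProbabilityMeasure_map (μ := P) h.1.aemeasurable
  refine Measure.ext_of_charFun (funext fun t => ?_)
  rw [charFun_isoNormal hv, charFun_apply, integral_map h.1.aemeasurable (by fun_prop)]
  have hm : Measurable fun ω => inner ℝ (Y ω) t := h.1.inner_const
  -- Cramér–Wold: the characteristic function of `Y` at `t` is that of the scalar `⟨Y, t⟩` at `1`,
  -- which the hypothesis provides.
  have h1 : charFun (P.map fun ω => inner ℝ (Y ω) t) 1 =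
      ∫ ω, Complex.exp (inner ℝ (Y ω) t * Complex.I) ∂P := by
    rw [charFun_apply_real, integral_map hm.aemeasurable (by fun_prop)]
    simp
  rw [← h1, h.2 t, charFun_gaussianReal, inner_smul_id, Real.coe_toNNReal _ (by positivity)]
  simp

/-- Needed to exhibit a concrete instance of the model. The characteristic function of `⟨Y, T⟩` at
`t` is that of `Y` at `t • T`. -/
theorem isNormalTensor_of_map_eq {Ω : Type*} [MeasurableSpace Ω] {P : Measure Ω}
    [IsProbabilityMeasure P] {Y : Ω → Tensor n} {v : ℝ} (hv : 0 < v) (hY : Measurable Y)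
    (h : P.map Y = isoNormal n v) : IsNormalTensor P Y 0 (v • LinearMap.id) := by
  refine ⟨hY, fun T => ?_⟩
  have hm : Measurable fun ω => inner ℝ (Y ω) T := hY.inner_const
  have := Measure.isProbabilityMeasure_map (μ := P) hm.aemeasurable
  refine Measure.ext_of_charFun (funext fun t => ?_)
  rw [charFun_gaussianReal, inner_smul_id, Real.coe_toNNReal _ (by positivity),
    charFun_apply_real, integral_map hm.aemeasurable (by fun_prop)]
  have h1 := charFun_isoNormal hv (t • T)
  rw [← h, charFun_apply, integral_map hY.aemeasurable (by fun_prop)] at h1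
  simp only [inner_smul_right, norm_smul] at h1
  simp only [Complex.ofReal_mul] at h1
  rw [h1]
  congr 1
  have ht : (‖t‖ : ℂ) ^ 2 = (t : ℂ) ^ 2 := by
    rw [Real.norm_eq_abs, ← Complex.ofReal_pow, sq_abs, Complex.ofReal_pow]
  rw [inner_zero_left, mul_pow, ht]
  push_cast
  ring

/-! ### Second moments of isotropic normal tensors -/

section Moments

variable {Ω : Type*} [MeasurableSpace Ω] {P : Measure Ω}
  {Y : Ω → Tensor n} {v : ℝ}

theorem IsNormalTensor.memLp_inner {C : Module.End ℝ (Tensor n)} (h : IsNormalTensor P Y 0 C)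
    (T : Tensor n) : MemLp (fun ω => inner ℝ (Y ω) T) 2 P := by
  have h1 := memLp_id_gaussianReal' (μ := inner ℝ (0 : Tensor n) T)
    (v := (inner ℝ (C T) T).toNNReal) 2 (by simp)
  rw [← h.2 T] at h1
  exact h1.comp_of_map h.1.inner_const.aemeasurable

theorem IsNormalTensor.integral_inner {C : Module.End ℝ (Tensor n)} (h : IsNormalTensor P Y 0 C)
    (T : Tensor n) : ∫ ω, inner ℝ (Y ω) T ∂P = 0 := by
  have h1 := integral_id_gaussianReal (μ := inner ℝ (0 : Tensor n) T)
    (v := (inner ℝ (C T) T).toNNReal)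
  rw [← h.2 T, integral_map h.1.inner_const.aemeasurable (by fun_prop)] at h1
  simpa using h1

theorem IsNormalTensor.integral_inner_sq (hv : 0 < v)
    (h : IsNormalTensor P Y 0 (v • LinearMap.id)) (T : Tensor n) :
    ∫ ω, inner ℝ (Y ω) T ^ 2 ∂P = v * ‖T‖ ^ 2 := by
  have hm : Measurable fun ω => inner ℝ (Y ω) T := h.1.inner_const
  have h1 := variance_id_gaussianReal (μ := inner ℝ (0 : Tensor n) T)
    (v := (inner ℝ ((v • LinearMap.id : Module.End ℝ (Tensor n)) T) T).toNNReal)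
  rw [← h.2 T, variance_map aemeasurable_id hm.aemeasurable, Function.id_comp,
    variance_of_integral_eq_zero hm.aemeasurable (h.integral_inner T), inner_smul_id,
    Real.coe_toNNReal _ (by positivity)] at h1
  exact h1

/-- Polarization of the second moments. -/
theorem IsNormalTensor.integral_inner_mul_inner (hv : 0 < v)
    (h : IsNormalTensor P Y 0 (v • LinearMap.id)) (S T : Tensor n) :
    ∫ ω, inner ℝ (Y ω) S * inner ℝ (Y ω) T ∂P = v * inner ℝ S T := by
  have e : ∀ ω, inner ℝ (Y ω) S * inner ℝ (Y ω) T =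
      (1 / 4) * (inner ℝ (Y ω) (S + T) ^ 2 - inner ℝ (Y ω) (S - T) ^ 2) := by
    intro ω; rw [inner_add_right, inner_sub_right]; ring
  simp_rw [e]
  rw [integral_const_mul, integral_sub (h.memLp_inner _).integrable_sq
    (h.memLp_inner _).integrable_sq, h.integral_inner_sq hv, h.integral_inner_sq hv,
    norm_add_sq_real, norm_sub_sq_real]
  ring

/-- A random tensor all of whose coordinates are square integrable is square integrable. -/
theorem memLp_of_forall_inner
    (h : ∀ T, MemLp (fun ω => inner ℝ (Y ω) T) 2 P) : MemLp Y 2 P := by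
  have e : Y = fun ω => ∑ i, (inner ℝ (Y ω) (EuclideanSpace.basisFun _ ℝ i) : ℝ) •
      (EuclideanSpace.basisFun (∀ k, Fin (n k)) ℝ i) := by
    funext ω
    conv_lhs => rw [← (EuclideanSpace.basisFun (∀ k, Fin (n k)) ℝ).sum_repr' (Y ω)]
    exact Finset.sum_congr rfl fun i _ => by rw [real_inner_comm]
  rw [e]
  exact memLp_finsetSum _ fun i _ =>
    (ContinuousLinearMap.toSpanSingleton ℝ
      (EuclideanSpace.basisFun (∀ k, Fin (n k)) ℝ i)).comp_memLp' (h _)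

end Moments

/-! ### The operator `M` -/

theorem opM_apply (θ : Params n m) (w : Tensor m) :
    opM θ w = tuckerAdj θ.A (tucker θ.A w) + θ.sigmaSq • w := by
  simp [opM]

theorem inner_opM (θ : Params n m) (a b : Tensor m) :
    inner ℝ (opM θ a) b = inner ℝ (tucker θ.A a) (tucker θ.A b) + θ.sigmaSq * inner ℝ a b := by
  rw [opM_apply, inner_add_left, LinearMap.adjoint_inner_left, inner_smul_left]
  rfl

theorem inner_opM_comm (θ : Params n m) (a b : Tensor m) :
    inner ℝ (opM θ a) b = inner ℝ a (opM θ b) := by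
  rw [inner_opM, real_inner_comm (opM θ b), inner_opM, real_inner_comm (tucker θ.A b),
    real_inner_comm b]

theorem sigmaSq_mul_le_inner_opM (θ : Params n m) (w : Tensor m) :
    θ.sigmaSq * ‖w‖ ^ 2 ≤ inner ℝ (opM θ w) w := by
  rw [inner_opM, real_inner_self_eq_norm_sq, real_inner_self_eq_norm_sq]
  nlinarith [sq_nonneg ‖tucker θ.A w‖]

/-- `M ≥ σ² I` with `σ² > 0` makes `M` injective, which suffices in finite dimension. -/
theorem isUnit_opM (θ : Params n m) : IsUnit (opM θ) := by
  rw [LinearMap.isUnit_iff_ker_eq_bot, LinearMap.ker_eq_bot']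
  intro w hw
  have h := sigmaSq_mul_le_inner_opM θ w
  rw [hw, inner_zero_left] at h
  have h2 : ‖w‖ ^ 2 ≤ 0 := by
    by_contra hc
    exact absurd h (not_le.2 (mul_pos θ.sigmaSq_pos (not_le.1 hc)))
  have h3 : ‖w‖ = 0 := by
    have := sq_nonneg ‖w‖
    exact pow_eq_zero_iff (two_ne_zero) |>.1 (le_antisymm h2 this)
  exact norm_eq_zero.1 h3

theorem opM_inverse_apply (θ : Params n m) (y : Tensor m) :
    opM θ (Ring.inverse (opM θ) y) = y := by
  have h := Ring.mul_inverse_cancel _ (isUnit_opM θ)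
  exact LinearMap.congr_fun h y

theorem inner_inverse_opM_comm (θ : Params n m) (a b : Tensor m) :
    inner ℝ (Ring.inverse (opM θ) a) b = inner ℝ a (Ring.inverse (opM θ) b) := by
  conv_lhs => rw [← opM_inverse_apply θ b]
  rw [← inner_opM_comm, opM_inverse_apply]

/-- From `M z - F*(F z + e) = σ² z - F* e`, the residual is `M⁻¹(σ² z - F* e)`; pairing with `S`
moves the self-adjoint `M⁻¹` onto `S`. This linear form in `(z, e)` is the source of all moments of
the residual. -/
theorem inner_residual (θ : Params n m) (z : Tensor m) (e : Tensor n) (S : Tensor m) :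
    inner ℝ (z - eMean θ (θ.mu + tucker θ.A z + e)) S =
      inner ℝ z (θ.sigmaSq • Ring.inverse (opM θ) S)
        - inner ℝ e (tucker θ.A (Ring.inverse (opM θ) S)) := by
  have h1 : θ.mu + tucker θ.A z + e - θ.mu = tucker θ.A z + e := by abel
  have h2 : inner ℝ z S = inner ℝ z (opM θ (Ring.inverse (opM θ) S)) := by
    rw [opM_inverse_apply]
  rw [inner_sub_left, eMean, h1, inner_inverse_opM_comm, LinearMap.adjoint_inner_left,
    inner_add_left, h2, ← inner_opM_comm, inner_opM, inner_smul_right]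
  ring

theorem opM_eMean (θ : Params n m) (x : Tensor n) :
    opM θ (eMean θ x) = tuckerAdj θ.A (x - θ.mu) := opM_inverse_apply θ _

theorem continuous_eMean (θ : Params n m) : Continuous (eMean θ) :=
  (LinearMap.continuous_of_finiteDimensional (Ring.inverse (opM θ) ∘ₗ tuckerAdj θ.A)).comp
    (continuous_id.sub continuous_const)

theorem continuous_tucker (A : Factors n m) : Continuous (tucker A) :=
  LinearMap.continuous_of_finiteDimensional _

/-! ### The conditional law of the latent tensor -/

/-- The unnormalized density of `Z - E(Z | X)`. -/
def residualKernel (θ : Params n m) (w : Tensor m) : ℝ :=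
  Real.exp (-(inner ℝ (opM θ w) w / (2 * θ.sigmaSq)))

theorem continuous_residualKernel (θ : Params n m) : Continuous (residualKernel θ) := by
  have h : Continuous (opM θ) := LinearMap.continuous_of_finiteDimensional _
  unfold residualKernel; fun_prop

theorem residualKernel_pos (θ : Params n m) (w : Tensor m) : 0 < residualKernel θ w :=
  Real.exp_pos _

/-- The bound `M ≥ σ² I` dominates the kernel by the standard Gaussian `exp(-‖w‖²/2)`. -/
theorem integrable_residualKernel (θ : Params n m) : Integrable (residualKernel θ) := by
  have hs := θ.sigmaSq_pos
  have h : Integrable fun w : Tensor m => Real.exp (-(1 / 2) * ‖w‖ ^ 2) := by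
    refine .of_integral_ne_zero ?_
    rw [GaussianFourier.integral_rexp_neg_mul_sq_norm (by norm_num)]
    positivity
  refine h.mono' (continuous_residualKernel θ).aestronglyMeasurable (ae_of_all _ fun w => ?_)
  rw [Real.norm_of_nonneg (residualKernel_pos θ w).le]
  refine Real.exp_le_exp.2 ?_
  have h1 : ‖w‖ ^ 2 / 2 ≤ inner ℝ (opM θ w) w / (2 * θ.sigmaSq) := by
    rw [le_div_iff₀ (by positivity)]
    linarith [sigmaSq_mul_le_inner_opM θ w]
  linarith

theorem integral_residualKernel_pos (θ : Params n m) : 0 < ∫ w, residualKernel θ w :=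
  integral_exp_pos (integrable_residualKernel θ)

theorem jointDensity_pos (θ : Params n m) (x : Tensor n) (z : Tensor m) :
    0 < jointDensity θ x z :=
  mul_pos (normalDensity_pos one_pos _ _) (normalDensity_pos θ.sigmaSq_pos _ _)

theorem continuous_jointDensity (θ : Params n m) :
    Continuous fun p : Tensor n × Tensor m => jointDensity θ p.1 p.2 := by
  have h := continuous_tucker θ.A
  unfold jointDensity normalDensity; fun_prop

/-- Completing the square in the latent variable. -/
theorem jointDensity_add_eMean (θ : Params n m) (x : Tensor n) (w : Tensor m) :
    jointDensity θ x (w + eMean θ x) = jointDensity θ x (eMean θ x) * residualKernel θ w := by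
  have hs := θ.sigmaSq_pos
  set E := eMean θ x with hE
  have h1 : ‖w + E‖ ^ 2 = ‖w‖ ^ 2 + 2 * inner ℝ w E + ‖E‖ ^ 2 := norm_add_sq_real _ _
  have h2 : ‖x - (θ.mu + tucker θ.A (w + E))‖ ^ 2 = ‖x - (θ.mu + tucker θ.A E)‖ ^ 2
      - 2 * inner ℝ (x - (θ.mu + tucker θ.A E)) (tucker θ.A w) + ‖tucker θ.A w‖ ^ 2 := by
    rw [← norm_sub_sq_real, map_add]
    congr 2; abel
  -- The equation `M E = F*(x - μ)` makes the terms linear in `w` from the prior and from the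
  -- likelihood cancel.
  have h3 : inner ℝ (x - (θ.mu + tucker θ.A E)) (tucker θ.A w) = θ.sigmaSq * inner ℝ w E := by
    have h4 : inner ℝ (opM θ E) w = inner ℝ (x - θ.mu) (tucker θ.A w) := by
      rw [hE, opM_eMean, LinearMap.adjoint_inner_left]
    rw [inner_opM] at h4
    rw [← sub_sub, inner_sub_left, ← h4, real_inner_comm w E]
    ring
  unfold jointDensity residualKernel normalDensity
  rw [inner_opM, real_inner_self_eq_norm_sq, real_inner_self_eq_norm_sq, sub_zero, sub_zero, h1,
    h2, h3]
  have e : ∀ a b c d f : ℝ, a * Real.exp c * (b * Real.exp d) * Real.exp f =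
      a * b * Real.exp (c + d + f) := by
    intro a b c d f; rw [Real.exp_add, Real.exp_add]; ring
  have e' : ∀ a b c d : ℝ, a * Real.exp c * (b * Real.exp d) = a * b * Real.exp (c + d) := by
    intro a b c d; rw [Real.exp_add]; ring
  rw [e, e']
  congr 2
  field_simp
  ring

theorem jointDensity_eq (θ : Params n m) (x : Tensor n) (z : Tensor m) :
    jointDensity θ x z =
      jointDensity θ x (eMean θ x) * residualKernel θ (z - eMean θ x) := by
  rw [← jointDensity_add_eMean, sub_add_cancel]

theorem integral_jointDensity (θ : Params n m) (x : Tensor n) :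
    ∫ z, jointDensity θ x z = jointDensity θ x (eMean θ x) * ∫ w, residualKernel θ w := by
  rw [integral_congr_ae (ae_of_all _ (jointDensity_eq θ x)), integral_const_mul, integral_sub_right_eq_self (residualKernel θ)]

/-- The law of `Z - E(Z | X)`. -/
def residualLaw (θ : Params n m) : Measure (Tensor m) :=
  volume.withDensity fun w => ENNReal.ofReal (residualKernel θ w / ∫ w', residualKernel θ w')

theorem measurable_residualDensity (θ : Params n m) :
    Measurable fun w => ENNReal.ofReal (residualKernel θ w / ∫ w', residualKernel θ w') :=
  ((continuous_residualKernel θ).div_const _).measurable.ennreal_ofReal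

instance isProbabilityMeasure_residualLaw (θ : Params n m) :
    IsProbabilityMeasure (residualLaw θ) := by
  constructor
  have hp := integral_residualKernel_pos θ
  rw [residualLaw, withDensity_apply _ MeasurableSet.univ, Measure.restrict_univ,
    ← ofReal_integral_eq_lintegral_ofReal ((integrable_residualKernel θ).div_const _)
      (ae_of_all _ fun w => div_nonneg (residualKernel_pos θ w).le hp.le),
    integral_div, div_self hp.ne', ENNReal.ofReal_one]

/-- The conditional law of the latent tensor is a translate of the residual law. -/
theorem latentPosterior_eq_map (θ : Params n m) (x : Tensor n) :
    latentPosterior θ x = (residualLaw θ).map fun w => w + eMean θ x := by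
  have h := map_withDensity_comp (measurePreserving_add_right volume (eMean θ x))
    (f := fun z => ENNReal.ofReal (jointDensity θ x z / ∫ z', jointDensity θ x z'))
    (((continuous_jointDensity θ).comp
      (Continuous.prodMk_right x)).div_const _).measurable.ennreal_ofReal
  rw [latentPosterior, ← h, residualLaw]
  congr 2
  funext w
  rw [jointDensity_add_eMean, integral_jointDensity,
    mul_div_mul_left _ _ (jointDensity_pos θ x _).ne']

/-! ### The law of the complete data -/

section Model

variable {Ω : Type*} [MeasurableSpace Ω] {P : Measure Ω}
  {θ : Params n m} {X : Ω → Tensor n} {Z : Ω → Tensor m}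

theorem IsTPCA.measurable_latent (h : IsTPCA P θ X Z) : Measurable Z := by
  obtain ⟨ε, hZ, -, -, -⟩ := h
  exact hZ.1

theorem IsTPCA.measurable_obs (h : IsTPCA P θ X Z) : Measurable X := by
  obtain ⟨ε, hZ, hε, -, hX⟩ := h
  rw [funext hX]
  exact (((continuous_tucker θ.A).measurable.comp hZ.1).const_add _).add hε.1

theorem IsTPCA.measurable_residual (h : IsTPCA P θ X Z) :
    Measurable fun ω => Z ω - eMean θ (X ω) :=
  h.measurable_latent.sub ((continuous_eMean θ).measurable.comp h.measurable_obs)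

variable [IsProbabilityMeasure P]

/-- `(Z, ε)` has a product density, and `(z, e) ↦ (μ + F z + e, z)` is a volume-preserving shear
followed by a swap; so the density is only re-expressed through `e = x - μ - F z`. -/
theorem IsTPCA.map_prod (h : IsTPCA P θ X Z) :
    P.map (fun ω => (X ω, Z ω)) =
      ((volume : Measure (Tensor n)).prod (volume : Measure (Tensor m))).withDensity
        fun p => ENNReal.ofReal (jointDensity θ p.1 p.2) := by
  obtain ⟨ε, hZ, hε, hind, hX⟩ := h
  have hF := continuous_tucker θ.A
  have hZl : P.map Z = isoNormal m 1 :=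
    IsNormalTensor.map_eq one_pos (by rwa [one_smul])
  have hεl := hε.map_eq θ.sigmaSq_pos
  have hm1 : Measurable fun z : Tensor m => ENNReal.ofReal (normalDensity 1 0 z) := by
    unfold normalDensity; fun_prop
  have hm2 : Measurable fun e : Tensor n => ENNReal.ofReal (normalDensity θ.sigmaSq 0 e) := by
    unfold normalDensity; fun_prop
  have hlaw : P.map (fun ω => (Z ω, ε ω)) =
      ((volume : Measure (Tensor m)).prod (volume : Measure (Tensor n))).withDensity
        fun p => ENNReal.ofReal (normalDensity 1 0 p.1) *
          ENNReal.ofReal (normalDensity θ.sigmaSq 0 p.2) := by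
    rw [(indepFun_iff_map_prod_eq_prod_map_map hZ.1.aemeasurable hε.1.aemeasurable).1 hind,
      hZl, hεl, isoNormal, isoNormal, prod_withDensity hm1 hm2]
  have hΦ : MeasurePreserving
      (fun p : Tensor m × Tensor n => (θ.mu + tucker θ.A p.1 + p.2, p.1))
      (volume.prod volume) (volume.prod volume) := by
    refine Measure.measurePreserving_swap.comp
      ((MeasurePreserving.id volume).skew_product
        (g := fun z e => θ.mu + tucker θ.A z + e) ?_ (ae_of_all _ fun z => ?_))
    · exact (by fun_prop : Continuous fun p : Tensor m × Tensor n =>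
        θ.mu + tucker θ.A p.1 + p.2).measurable
    · exact (measurePreserving_add_left volume (θ.mu + tucker θ.A z)).map_eq
  rw [← map_withDensity_comp hΦ (continuous_jointDensity θ).measurable.ennreal_ofReal]
  have e1 : (fun ω => (X ω, Z ω)) =
      (fun p : Tensor m × Tensor n => (θ.mu + tucker θ.A p.1 + p.2, p.1)) ∘
        fun ω => (Z ω, ε ω) := by
    funext ω; simp [hX]
  rw [e1, ← Measure.map_map hΦ.measurable (hZ.1.prodMk hε.1), hlaw]
  congr 2
  funext p
  rw [jointDensity, ENNReal.ofReal_mul (normalDensity_pos one_pos _ _).le]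
  congr 2
  simp [normalDensity]

/-- The observed tensor and the residual `Z - E(Z | X)` are independent, and the residual has the
law `residualLaw θ`. -/
theorem IsTPCA.map_obs_residual (h : IsTPCA P θ X Z) :
    P.map (fun ω => (X ω, Z ω - eMean θ (X ω))) = (P.map X).prod (residualLaw θ) := by
  have hXm := h.measurable_obs
  have hZm := h.measurable_latent
  have hE := continuous_eMean θ
  have hJ := continuous_jointDensity θ
  have hp := integral_residualKernel_pos θ
  have hΨ : MeasurePreserving (fun p : Tensor n × Tensor m => (p.1, p.2 - eMean θ p.1))
      (volume.prod volume) (volume.prod volume) := by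
    refine (MeasurePreserving.id volume).skew_product
      (g := fun x z => z - eMean θ x) ?_ (ae_of_all _ fun x => ?_)
    · exact (by fun_prop : Continuous fun p : Tensor n × Tensor m =>
        p.2 - eMean θ p.1).measurable
    · exact (measurePreserving_sub_right volume (eMean θ x)).map_eq
  have hq : Measurable fun x : Tensor n => ENNReal.ofReal
      (jointDensity θ x (eMean θ x) * ∫ w, residualKernel θ w) :=
    ((hJ.comp (continuous_id.prodMk hE)).mul_const _).measurable.ennreal_ofReal
  have h1 : P.map (fun ω => (X ω, Z ω - eMean θ (X ω))) =
      ((volume : Measure (Tensor n)).withDensity fun x => ENNReal.ofReal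
        (jointDensity θ x (eMean θ x) * ∫ w, residualKernel θ w)).prod (residualLaw θ) := by
    have e1 : (fun ω => (X ω, Z ω - eMean θ (X ω))) =
        (fun p : Tensor n × Tensor m => (p.1, p.2 - eMean θ p.1)) ∘ fun ω => (X ω, Z ω) := rfl
    have h0 := map_withDensity_comp hΨ
      ((hq.comp measurable_fst).mul ((measurable_residualDensity θ).comp measurable_snd))
    rw [e1, ← Measure.map_map hΨ.measurable (hXm.prodMk hZm), h.map_prod, residualLaw,
      prod_withDensity hq (measurable_residualDensity θ)]
    -- By the completed square, the joint density is a product of a function of `x` and a function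
    -- of `z - E(x)`, hence a product density pulled back along the shear.
    refine Eq.trans ?_ h0
    congr 2
    funext p
    simp only [Pi.mul_apply, Function.comp_apply]
    rw [← ENNReal.ofReal_mul (mul_pos (jointDensity_pos θ _ _) hp).le, jointDensity_eq]
    congr 1
    field_simp
  -- The density of `X` needs no separate integration: it is the first marginal of the product just
  -- found, the residual law having mass one.
  have h2 : P.map X = (volume : Measure (Tensor n)).withDensity fun x => ENNReal.ofReal
        (jointDensity θ x (eMean θ x) * ∫ w, residualKernel θ w) := by
    have := congrArg Measure.fst h1
    rw [Measure.fst_map_prodMk h.measurable_residual, Measure.fst_prod] at this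
    exact this
  rw [h1, h2]

theorem IsTPCA.map_residual (h : IsTPCA P θ X Z) :
    P.map (fun ω => Z ω - eMean θ (X ω)) = residualLaw θ := by
  have := Measure.isProbabilityMeasure_map (μ := P) h.measurable_obs.aemeasurable
  have h1 := congrArg Measure.snd h.map_obs_residual
  rwa [Measure.snd_map_prodMk h.measurable_obs, Measure.snd_prod] at h1

theorem IsTPCA.indepFun_residual (h : IsTPCA P θ X Z) :
    IndepFun X (fun ω => Z ω - eMean θ (X ω)) P := by
  rw [indepFun_iff_map_prod_eq_prod_map_map h.measurable_obs.aemeasurable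
    h.measurable_residual.aemeasurable, h.map_obs_residual, h.map_residual]

end Model

/-! ### Moments of the residual law -/

/-- The canonical realization of the model. -/
theorem isTPCA_prod (θ : Params n m) :
    IsTPCA ((isoNormal m 1).prod (isoNormal n θ.sigmaSq)) θ
      (fun p => θ.mu + tucker θ.A p.1 + p.2) Prod.fst := by
  have := isProbabilityMeasure_isoNormal (n := m) one_pos
  have := isProbabilityMeasure_isoNormal (n := n) θ.sigmaSq_pos
  refine ⟨Prod.snd, ?_, ?_, ?_, fun _ => rfl⟩
  · rw [← one_smul ℝ (LinearMap.id : Module.End ℝ (Tensor m))]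
    exact isNormalTensor_of_map_eq one_pos measurable_fst
      (by rw [Measure.map_fst_prod, measure_univ, one_smul])
  · exact isNormalTensor_of_map_eq θ.sigmaSq_pos measurable_snd
      (by rw [Measure.map_snd_prod, measure_univ, one_smul])
  · exact indepFun_prod (X := id) (Y := id) measurable_id measurable_id

section Model

variable {Ω : Type*} [MeasurableSpace Ω] {P : Measure Ω}
  {θ : Params n m} {X : Ω → Tensor n} {Z : Ω → Tensor m}

theorem IsTPCA.memLp_inner_residual (h : IsTPCA P θ X Z) (S : Tensor m) :
    MemLp (fun ω => inner ℝ (Z ω - eMean θ (X ω)) S) 2 P := by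
  obtain ⟨ε, hZ, hε, -, hX⟩ := h
  simp_rw [hX, inner_residual]
  exact (hZ.memLp_inner _).sub (hε.memLp_inner _)

theorem IsTPCA.memLp_latent (h : IsTPCA P θ X Z) : MemLp Z 2 P := by
  obtain ⟨ε, hZ, -, -, -⟩ := h
  exact memLp_of_forall_inner hZ.memLp_inner

/-- The covariance of `M⁻¹(σ² Z - F* ε)` is `σ⁴ M⁻² + σ² M⁻¹ F* F M⁻¹ = σ² M⁻¹ (σ² I + F* F) M⁻¹ =
σ² M⁻¹`. -/
theorem IsTPCA.integral_inner_residual_mul (h : IsTPCA P θ X Z) (S T : Tensor m) :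
    ∫ ω, inner ℝ (Z ω - eMean θ (X ω)) S * inner ℝ (Z ω - eMean θ (X ω)) T ∂P =
      inner ℝ (eCov θ S) T := by
  obtain ⟨ε, hZ, hε, hind, hX⟩ := h
  have hZ1 : IsNormalTensor P Z 0 ((1 : ℝ) • LinearMap.id) := by rwa [one_smul]
  simp_rw [hX, inner_residual]
  set a := θ.sigmaSq • Ring.inverse (opM θ) S with ha
  set b := tucker θ.A (Ring.inverse (opM θ) S) with hb
  set c := θ.sigmaSq • Ring.inverse (opM θ) T with hc
  set d := tucker θ.A (Ring.inverse (opM θ) T) with hd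
  have cross : ∀ (u : Tensor m) (v : Tensor n),
      ∫ ω, inner ℝ (Z ω) u * inner ℝ (ε ω) v ∂P = 0 := by
    intro u v
    have hi : IndepFun (fun ω => inner ℝ (Z ω) u) (fun ω => inner ℝ (ε ω) v) P :=
      hind.comp (φ := fun z => inner ℝ z u) (ψ := fun e => inner ℝ e v)
        (by fun_prop) (by fun_prop)
    rw [hi.integral_fun_mul_eq_mul_integral (hZ.memLp_inner u).1 (hε.memLp_inner v).1,
      hZ.integral_inner, zero_mul]
  have e : ∀ ω, (inner ℝ (Z ω) a - inner ℝ (ε ω) b) * (inner ℝ (Z ω) c - inner ℝ (ε ω) d) =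
      inner ℝ (Z ω) a * inner ℝ (Z ω) c - inner ℝ (Z ω) a * inner ℝ (ε ω) d
        - inner ℝ (Z ω) c * inner ℝ (ε ω) b + inner ℝ (ε ω) b * inner ℝ (ε ω) d := by
    intro ω; ring
  simp_rw [e]
  have i1 : Integrable (fun ω => inner ℝ (Z ω) a * inner ℝ (Z ω) c) P :=
    (hZ.memLp_inner a).integrable_mul (hZ.memLp_inner c)
  have i2 : Integrable (fun ω => inner ℝ (Z ω) a * inner ℝ (ε ω) d) P :=
    (hZ.memLp_inner a).integrable_mul (hε.memLp_inner d)
  have i3 : Integrable (fun ω => inner ℝ (Z ω) c * inner ℝ (ε ω) b) P :=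
    (hZ.memLp_inner c).integrable_mul (hε.memLp_inner b)
  have i4 : Integrable (fun ω => inner ℝ (ε ω) b * inner ℝ (ε ω) d) P :=
    (hε.memLp_inner b).integrable_mul (hε.memLp_inner d)
  rw [integral_add (by exact (i1.sub i2).sub i3) i4, integral_sub (by exact i1.sub i2) i3,
    integral_sub i1 i2,
    cross, cross, hZ1.integral_inner_mul_inner one_pos,
    hε.integral_inner_mul_inner θ.sigmaSq_pos, eCov, LinearMap.smul_apply]
  -- This is the collapse `M⁻¹ (F* F + σ² I) M⁻¹ = M⁻¹`, tested against `S` and `T`.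
  have k := inner_opM θ (Ring.inverse (opM θ) S) (Ring.inverse (opM θ) T)
  rw [opM_inverse_apply, ← inner_inverse_opM_comm] at k
  simp only [ha, hb, hc, hd, inner_smul_left, inner_smul_right, conj_trivial, k]
  ring

variable [IsProbabilityMeasure P]

theorem IsTPCA.integral_inner_residual (h : IsTPCA P θ X Z) (S : Tensor m) :
    ∫ ω, inner ℝ (Z ω - eMean θ (X ω)) S ∂P = 0 := by
  obtain ⟨ε, hZ, hε, -, hX⟩ := h
  simp_rw [hX, inner_residual]
  rw [integral_sub ((hZ.memLp_inner _).integrable one_le_two)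
    ((hε.memLp_inner _).integrable one_le_two), hZ.integral_inner, hε.integral_inner, sub_zero]

theorem IsTPCA.memLp_obs (h : IsTPCA P θ X Z) : MemLp X 2 P := by
  have hZ := h.memLp_latent
  obtain ⟨ε, -, hε, -, hX⟩ := h
  rw [funext hX]
  exact ((memLp_const θ.mu).add
    ((LinearMap.toContinuousLinearMap (tucker θ.A)).comp_memLp' hZ)).add
      (memLp_of_forall_inner hε.memLp_inner)

end Model

/-- Realizes the residual law, so far known by its density alone, inside the canonical model, so
that its moments can be read off there. -/
theorem residualLaw_eq_map (θ : Params n m) :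
    residualLaw θ = ((isoNormal m 1).prod (isoNormal n θ.sigmaSq)).map
      fun p => p.1 - eMean θ (θ.mu + tucker θ.A p.1 + p.2) := by
  have := isProbabilityMeasure_isoNormal (n := m) one_pos
  have := isProbabilityMeasure_isoNormal (n := n) θ.sigmaSq_pos
  exact (isTPCA_prod θ).map_residual.symm

theorem memLp_inner_residualLaw (θ : Params n m) (S : Tensor m) :
    MemLp (fun w => inner ℝ w S) 2 (residualLaw θ) := by
  have := isProbabilityMeasure_isoNormal (n := m) one_pos
  have := isProbabilityMeasure_isoNormal (n := n) θ.sigmaSq_pos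
  rw [residualLaw_eq_map, memLp_map_measure_iff (by fun_prop)
    (isTPCA_prod θ).measurable_residual.aemeasurable]
  exact (isTPCA_prod θ).memLp_inner_residual S

theorem memLp_residualLaw (θ : Params n m) : MemLp (fun w => w) 2 (residualLaw θ) :=
  memLp_of_forall_inner (memLp_inner_residualLaw θ)

theorem integral_inner_residualLaw (θ : Params n m) (S : Tensor m) :
    ∫ w, inner ℝ w S ∂(residualLaw θ) = 0 := by
  have := isProbabilityMeasure_isoNormal (n := m) one_pos
  have := isProbabilityMeasure_isoNormal (n := n) θ.sigmaSq_pos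
  rw [residualLaw_eq_map, integral_map (isTPCA_prod θ).measurable_residual.aemeasurable
    (by fun_prop)]
  exact (isTPCA_prod θ).integral_inner_residual S

theorem integral_inner_mul_residualLaw (θ : Params n m) (S T : Tensor m) :
    ∫ w, inner ℝ w S * inner ℝ w T ∂(residualLaw θ) = inner ℝ (eCov θ S) T := by
  have := isProbabilityMeasure_isoNormal (n := m) one_pos
  have := isProbabilityMeasure_isoNormal (n := n) θ.sigmaSq_pos
  rw [residualLaw_eq_map, integral_map (isTPCA_prod θ).measurable_residual.aemeasurable
    (by fun_prop)]
  exact (isTPCA_prod θ).integral_inner_residual_mul S T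

theorem integrable_residualLaw (θ : Params n m) : Integrable (fun w => w) (residualLaw θ) :=
  (memLp_residualLaw θ).integrable one_le_two

theorem integral_residualLaw (θ : Params n m) : ∫ w, w ∂(residualLaw θ) = 0 := by
  refine ext_inner_right ℝ fun S => ?_
  rw [real_inner_comm, ← integral_inner (integrable_residualLaw θ), inner_zero_left]
  simpa only [real_inner_comm S] using integral_inner_residualLaw θ S

theorem integrable_norm_sub_sq_residualLaw {k : Fin r → ℕ} (θ : Params n m)
    (L : Tensor m →ₗ[ℝ] Tensor k) (c : Tensor k) :
    Integrable (fun w => ‖c - L w‖ ^ 2) (residualLaw θ) :=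
  ((memLp_const c).sub
    ((LinearMap.toContinuousLinearMap L).comp_memLp' (memLp_residualLaw θ))).norm.integrable_sq

/-- In an orthonormal basis `b`, `‖L w‖²` is the sum of `⟨w, L* bᵢ⟩²`, and the covariances along the
`L* bᵢ` add up to the trace. -/
theorem integral_norm_sq_residualLaw {k : Fin r → ℕ} (θ : Params n m)
    (L : Tensor m →ₗ[ℝ] Tensor k) :
    ∫ w, ‖L w‖ ^ 2 ∂(residualLaw θ) =
      LinearMap.trace ℝ (Tensor k) (L ∘ₗ eCov θ ∘ₗ LinearMap.adjoint L) := by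
  set b := EuclideanSpace.basisFun (∀ j, Fin (k j)) ℝ
  have e : ∀ w, ‖L w‖ ^ 2 = ∑ i, inner ℝ w (LinearMap.adjoint L (b i)) *
      inner ℝ w (LinearMap.adjoint L (b i)) := by
    intro w
    rw [← b.sum_sq_norm_inner_left (L w)]
    refine Finset.sum_congr rfl fun i _ => ?_
    rw [LinearMap.adjoint_inner_right, Real.norm_eq_abs, sq_abs, sq]
  simp_rw [e]
  rw [integral_finsetSum _ fun i _ => by
      exact (memLp_inner_residualLaw θ _).integrable_mul (memLp_inner_residualLaw θ _),
    LinearMap.trace_eq_sum_inner _ b]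
  refine Finset.sum_congr rfl fun i _ => ?_
  rw [integral_inner_mul_residualLaw, LinearMap.adjoint_inner_right, real_inner_comm]
  rfl

theorem integral_norm_sub_sq_residualLaw {k : Fin r → ℕ} (θ : Params n m)
    (L : Tensor m →ₗ[ℝ] Tensor k) (c : Tensor k) :
    ∫ w, ‖c - L w‖ ^ 2 ∂(residualLaw θ) =
      ‖c‖ ^ 2 + LinearMap.trace ℝ (Tensor k) (L ∘ₗ eCov θ ∘ₗ LinearMap.adjoint L) := by
  have e : ∀ w, ‖c - L w‖ ^ 2 =
      ‖c‖ ^ 2 - 2 * inner ℝ w (LinearMap.adjoint L c) + ‖L w‖ ^ 2 := by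
    intro w
    rw [norm_sub_sq_real, LinearMap.adjoint_inner_right, real_inner_comm]
  have i1 := ((memLp_inner_residualLaw θ (LinearMap.adjoint L c)).integrable one_le_two).const_mul 2
  have i2 : Integrable (fun w => ‖L w‖ ^ 2) (residualLaw θ) := by
    simpa using integrable_norm_sub_sq_residualLaw θ L 0
  simp_rw [e]
  rw [integral_add (by exact (integrable_const _).sub i1) i2, integral_sub (integrable_const _) i1,
    integral_const_mul, integral_inner_residualLaw, integral_norm_sq_residualLaw]
  simp

/-! ### The expected complete-data log-likelihood -/

theorem isProbabilityMeasure_latentPosterior (θ : Params n m) (x : Tensor n) :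
    IsProbabilityMeasure (latentPosterior θ x) := by
  rw [latentPosterior_eq_map]
  exact Measure.isProbabilityMeasure_map (by fun_prop)

theorem integrable_latentPosterior (θ : Params n m) (x : Tensor n) :
    Integrable (fun z => z) (latentPosterior θ x) := by
  rw [latentPosterior_eq_map, integrable_map_measure (by fun_prop) (by fun_prop)]
  exact (integrable_residualLaw θ).add (integrable_const _)

theorem integral_latentPosterior (θ : Params n m) (x : Tensor n) :
    ∫ z, z ∂(latentPosterior θ x) = eMean θ x := by
  rw [latentPosterior_eq_map, integral_map (by fun_prop) (by fun_prop),
    integral_add (integrable_residualLaw θ) (integrable_const _), integral_residualLaw]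
  simp

theorem integral_inner_mul_latentPosterior (θ : Params n m) (x : Tensor n) (S T : Tensor m) :
    ∫ z, inner ℝ (z - eMean θ x) S * inner ℝ (z - eMean θ x) T ∂(latentPosterior θ x) =
      inner ℝ (eCov θ S) T := by
  rw [latentPosterior_eq_map, integral_map (by fun_prop) (by fun_prop)]
  simp only [add_sub_cancel_right]
  exact integral_inner_mul_residualLaw θ S T

theorem log_jointDensity (θ : Params n m) (x : Tensor n) (z : Tensor m) :
    Real.log (jointDensity θ x z) =
      -((dim n + dim m) / 2 * Real.log (2 * Real.pi)) - dim n / 2 * Real.log θ.sigmaSq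
        - 1 / 2 * ‖z‖ ^ 2 - 1 / (2 * θ.sigmaSq) * ‖x - θ.mu - tucker θ.A z‖ ^ 2 := by
  rw [jointDensity, Real.log_mul (normalDensity_pos one_pos _ _).ne'
    (normalDensity_pos θ.sigmaSq_pos _ _).ne', log_normalDensity one_pos,
    log_normalDensity θ.sigmaSq_pos, sub_zero, Real.log_one, sub_sub x]
  ring

theorem continuous_log_jointDensity_right (θ : Params n m) (x : Tensor n) :
    Continuous fun z : Tensor m => Real.log (jointDensity θ x z) := by
  have h := continuous_tucker θ.A
  simp only [log_jointDensity]
  fun_prop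

/-- Both quadratic terms take the shape `‖c - L w‖²`, with `L` the identity or the Tucker map, so
that one moment formula integrates both. -/
theorem log_jointDensity_add_eMean (θ₀ θ : Params n m) (x : Tensor n) (w : Tensor m) :
    Real.log (jointDensity θ x (w + eMean θ₀ x)) =
      -((dim n + dim m) / 2 * Real.log (2 * Real.pi)) - dim n / 2 * Real.log θ.sigmaSq
        - 1 / 2 * ‖-eMean θ₀ x - (LinearMap.id : Module.End ℝ (Tensor m)) w‖ ^ 2
        - 1 / (2 * θ.sigmaSq) *
          ‖x - θ.mu - tucker θ.A (eMean θ₀ x) - tucker θ.A w‖ ^ 2 := by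
  have h : ‖-eMean θ₀ x - (LinearMap.id : Module.End ℝ (Tensor m)) w‖ = ‖w + eMean θ₀ x‖ := by
    rw [LinearMap.id_apply, ← norm_neg]; congr 1; abel
  rw [log_jointDensity, h, map_add, sub_sub _ (tucker θ.A (eMean θ₀ x)),
    add_comm (tucker θ.A w)]

theorem integrable_log_jointDensity (θ₀ θ : Params n m) (x : Tensor n) :
    Integrable (fun z => Real.log (jointDensity θ x z)) (latentPosterior θ₀ x) := by
  have hc : Continuous fun z => Real.log (jointDensity θ x z) :=
    continuous_log_jointDensity_right θ x
  rw [latentPosterior_eq_map, integrable_map_measure hc.aestronglyMeasurable (by fun_prop)]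
  simp only [Function.comp_def, log_jointDensity_add_eMean]
  exact ((integrable_const _).sub
    ((integrable_norm_sub_sq_residualLaw θ₀ _ _).const_mul _)).sub
      ((integrable_norm_sub_sq_residualLaw θ₀ _ _).const_mul _)

theorem integral_log_jointDensity_eq_residualLaw (θ₀ θ : Params n m) (x : Tensor n) :
    ∫ z, Real.log (jointDensity θ x z) ∂(latentPosterior θ₀ x) =
      ∫ w, Real.log (jointDensity θ x (w + eMean θ₀ x)) ∂(residualLaw θ₀) := by
  have hc : Continuous fun z => Real.log (jointDensity θ x z) :=
    continuous_log_jointDensity_right θ x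
  rw [latentPosterior_eq_map, integral_map (by fun_prop) hc.aestronglyMeasurable]

theorem integral_log_jointDensity (θ₀ θ : Params n m) (x : Tensor n) :
    ∫ z, Real.log (jointDensity θ x z) ∂(latentPosterior θ₀ x) =
      -((dim n + dim m) / 2 * Real.log (2 * Real.pi)) - dim n / 2 * Real.log θ.sigmaSq
        - 1 / 2 * (‖eMean θ₀ x‖ ^ 2 + LinearMap.trace ℝ (Tensor m) (eCov θ₀))
        - 1 / (2 * θ.sigmaSq) * (‖x - θ.mu - tucker θ.A (eMean θ₀ x)‖ ^ 2
          + traceTerm (eCov θ₀) θ.A) := by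
  rw [integral_log_jointDensity_eq_residualLaw]
  simp only [log_jointDensity_add_eMean]
  have i1 := (integrable_norm_sub_sq_residualLaw θ₀ (LinearMap.id : Module.End ℝ (Tensor m))
    (-eMean θ₀ x)).const_mul (1 / 2)
  have i2 := (integrable_norm_sub_sq_residualLaw θ₀ (tucker θ.A)
    (x - θ.mu - tucker θ.A (eMean θ₀ x))).const_mul (1 / (2 * θ.sigmaSq))
  rw [integral_sub (by exact (integrable_const _).sub i1) i2, integral_sub (integrable_const _) i1,
    integral_const_mul, integral_const_mul, integral_norm_sub_sq_residualLaw,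
    integral_norm_sub_sq_residualLaw]
  simp [traceTerm]

theorem emQ_eq {N : ℕ} (x : Fin N → Tensor n) (θ₀ θ : Params n m) :
    emQ x θ₀ θ =
      -(N * (dim n + dim m) / 2 * Real.log (2 * Real.pi))
      - 1 / 2 * ∑ i, ‖eMean θ₀ (x i)‖ ^ 2
      - dim n * N / 2 * Real.log θ.sigmaSq
      - 1 / (2 * θ.sigmaSq) * rss x (fun i => eMean θ₀ (x i)) θ.A θ.mu
      - N / 2 * LinearMap.trace ℝ (Tensor m) (eCov θ₀)
      - N / (2 * θ.sigmaSq) * traceTerm (eCov θ₀) θ.A := by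
  rw [emQ, rss]
  simp only [integral_log_jointDensity, Finset.sum_sub_distrib, ← Finset.mul_sum,
    Finset.sum_add_distrib, Finset.sum_const, Finset.card_univ, Fintype.card_fin, nsmul_eq_mul]
  ring

/-! ### The M-step -/

/-- Isolates the dependence on `θ`: the parenthesized constant involves only the data and `θ₀`, and
`(A, ν)` enters through the M-step objective alone. -/
theorem emQ_eq_mObjective {N : ℕ} (hN : 0 < N) (x : Fin N → Tensor n) (θ₀ θ : Params n m) :
    emQ x θ₀ θ =
      (-(N * (dim n + dim m) / 2 * Real.log (2 * Real.pi))
        - 1 / 2 * ∑ i, ‖eMean θ₀ (x i)‖ ^ 2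
        - N / 2 * LinearMap.trace ℝ (Tensor m) (eCov θ₀))
      - N / 2 * (dim n * Real.log θ.sigmaSq + mObjective x θ₀ θ.A θ.mu / θ.sigmaSq) := by
  have hs := θ.sigmaSq_pos
  have hN' : (0 : ℝ) < N := by exact_mod_cast hN
  rw [emQ_eq, mObjective]
  field_simp
  ring

theorem emQ_le_iff {N : ℕ} (hN : 0 < N) (x : Fin N → Tensor n) (θ₀ θ θ' : Params n m) :
    emQ x θ₀ θ' ≤ emQ x θ₀ θ ↔
      dim n * Real.log θ.sigmaSq + mObjective x θ₀ θ.A θ.mu / θ.sigmaSq ≤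
        dim n * Real.log θ'.sigmaSq + mObjective x θ₀ θ'.A θ'.mu / θ'.sigmaSq := by
  have hN' : (0 : ℝ) < N / 2 := by positivity
  rw [emQ_eq_mObjective hN, emQ_eq_mObjective hN, sub_le_sub_iff_left, mul_le_mul_iff_right₀ hN']

theorem emQ_le_iff_mObjective_le {N : ℕ} (hN : 0 < N) (x : Fin N → Tensor n) (θ₀ : Params n m)
    {s : ℝ} (hs : 0 < s) (A A' : Factors n m) (ν ν' : Tensor m) :
    emQ x θ₀ ⟨A', ν', s, hs⟩ ≤ emQ x θ₀ ⟨A, ν, s, hs⟩ ↔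
      mObjective x θ₀ A (tucker A ν) ≤ mObjective x θ₀ A' (tucker A' ν') := by
  rw [emQ_le_iff hN, add_le_add_iff_left, div_le_div_iff_of_pos_right hs]
  rfl

theorem tucker_eq_zero_of_isUnit_gram {A : Factors n m} (hA : IsUnit (gram A)) {ν : Tensor m}
    (h : tucker A ν = 0) : ν = 0 := by
  rw [LinearMap.isUnit_iff_ker_eq_bot, LinearMap.ker_eq_bot'] at hA
  exact hA ν (by simp [gram, h])

/-- The objective in `ν` is the value at the update plus the squared distance from it. -/
theorem mObjective_eq_add {N : ℕ} (hN : 0 < N) (x : Fin N → Tensor n) (θ₀ : Params n m)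
    {A : Factors n m} (hA : IsUnit (gram A)) (ν : Tensor m) :
    mObjective x θ₀ A (tucker A ν) = mObjective x θ₀ A (tucker A (nuUpdate x θ₀ A))
      + ‖tucker A (ν - nuUpdate x θ₀ A)‖ ^ 2 := by
  have hN' : (N : ℝ) ≠ 0 := by exact_mod_cast hN.ne'
  set ν₁ := nuUpdate x θ₀ A
  set y : Fin N → Tensor n := fun i => x i - tucker A (eMean θ₀ (x i)) with hy
  have hgram : tuckerAdj A (tucker A ν₁) = tuckerAdj A ((1 / (N : ℝ)) • ∑ i, y i) :=
    LinearMap.congr_fun (Ring.mul_inverse_cancel _ hA) _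
  -- The normal equations `hgram` say that the mean residual at the update is orthogonal to the
  -- image of `tucker A`.
  have hcross : ∑ i, inner ℝ (y i - tucker A ν₁) (tucker A (ν - ν₁)) = 0 := by
    rw [← sum_inner, Finset.sum_sub_distrib, Finset.sum_const, Finset.card_univ,
      Fintype.card_fin]
    have e : ∑ i, y i - N • tucker A ν₁ =
        (N : ℝ) • ((1 / (N : ℝ)) • ∑ i, y i - tucker A ν₁) := by
      rw [smul_sub, smul_smul, mul_one_div_cancel hN', one_smul, Nat.cast_smul_eq_nsmul]
    rw [e, inner_smul_left, ← LinearMap.adjoint_inner_left, map_sub, ← hgram, sub_self,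
      inner_zero_left, mul_zero]
  have hterm : ∀ i, ‖x i - tucker A ν - tucker A (eMean θ₀ (x i))‖ ^ 2 =
      ‖x i - tucker A ν₁ - tucker A (eMean θ₀ (x i))‖ ^ 2
        - 2 * inner ℝ (y i - tucker A ν₁) (tucker A (ν - ν₁)) + ‖tucker A (ν - ν₁)‖ ^ 2 := by
    intro i
    have e1 : x i - tucker A ν - tucker A (eMean θ₀ (x i)) =
        (y i - tucker A ν₁) - tucker A (ν - ν₁) := by rw [map_sub]; simp only [hy]; abel
    have e2 : x i - tucker A ν₁ - tucker A (eMean θ₀ (x i)) = y i - tucker A ν₁ := by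
      simp only [hy]; abel
    rw [e1, e2, norm_sub_sq_real]
  rw [mObjective, mObjective, rss, rss]
  simp only [hterm]
  rw [Finset.sum_add_distrib, Finset.sum_sub_distrib, ← Finset.mul_sum, hcross, Finset.sum_const,
    Finset.card_univ, Fintype.card_fin, nsmul_eq_mul]
  field_simp
  ring

theorem forall_mObjective_le_iff {N : ℕ} (hN : 0 < N) (x : Fin N → Tensor n) (θ₀ : Params n m)
    {A : Factors n m} (hA : IsUnit (gram A)) (ν : Tensor m) :
    (∀ ν', mObjective x θ₀ A (tucker A ν) ≤ mObjective x θ₀ A (tucker A ν')) ↔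
      ν = nuUpdate x θ₀ A := by
  constructor
  · intro h
    have h1 := h (nuUpdate x θ₀ A)
    rw [mObjective_eq_add hN x θ₀ hA ν] at h1
    have h2 : ‖tucker A (ν - nuUpdate x θ₀ A)‖ ^ 2 = 0 :=
      le_antisymm (by linarith) (sq_nonneg _)
    exact sub_eq_zero.1 (tucker_eq_zero_of_isUnit_gram hA
      (norm_eq_zero.1 (pow_eq_zero_iff two_ne_zero |>.1 h2)))
  · rintro rfl ν'
    rw [mObjective_eq_add hN x θ₀ hA ν']
    exact le_add_of_nonneg_right (sq_nonneg _)

/-- Necessity is the vanishing of the derivative, `d s = g`; sufficiency is `log u ≤ u - 1` at `u =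
s / t`. No sign of `g` is assumed: for `g ≤ 0` both sides fail. -/
theorem forall_log_add_div_le_iff {d : ℝ} (hd : 0 < d) (g : ℝ) {s : ℝ} (hs : 0 < s) :
    (∀ t, 0 < t → d * Real.log s + g / s ≤ d * Real.log t + g / t) ↔ s = g / d := by
  constructor
  · intro h
    have hmin : IsLocalMin (fun t => d * Real.log t + g * t⁻¹) s := by
      filter_upwards [lt_mem_nhds hs] with t ht
      simpa only [div_eq_mul_inv] using h t ht
    have hder : HasDerivAt (fun t => d * Real.log t + g * t⁻¹)
        (d * s⁻¹ + g * (-(s ^ 2)⁻¹)) s :=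
      ((Real.hasDerivAt_log hs.ne').const_mul d).add ((hasDerivAt_inv hs.ne').const_mul g)
    have h0 := hmin.hasDerivAt_eq_zero hder
    field_simp at h0
    rw [eq_div_iff hd.ne']
    linarith
  · rintro hsg t ht
    have hg : g = d * s := by rw [hsg]; field_simp
    have h1 := Real.log_le_sub_one_of_pos (div_pos hs ht)
    rw [Real.log_div hs.ne' ht.ne'] at h1
    have h2 := mul_le_mul_of_nonneg_left h1 hd.le
    have h3 : g / s = d := by rw [hg]; field_simp
    have h4 : g / t = d * (s / t) := by rw [hg]; ring
    rw [h3, h4]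
    linarith

theorem dim_pos (hn : ∀ k, 0 < n k) : 0 < dim n := by
  rw [dim]
  exact_mod_cast Finset.prod_pos fun k _ => hn k

theorem sigmaSqUpdate_eq {N : ℕ} (x : Fin N → Tensor n) (θ₀ : Params n m) (A : Factors n m)
    (μ : Tensor n) : sigmaSqUpdate x θ₀ A μ = mObjective x θ₀ A μ / dim n := by
  rw [sigmaSqUpdate, mObjective, one_div_mul_eq_div, one_div_mul_eq_div, one_div_mul_eq_div,
    add_div, div_div, mul_comm (N : ℝ)]

theorem forall_emQ_le_iff_sigmaSq {N : ℕ} (hn : ∀ k, 0 < n k) (hN : 0 < N)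
    (x : Fin N → Tensor n) (θ₀ : Params n m) {s : ℝ} (hs : 0 < s) (A : Factors n m)
    (ν : Tensor m) :
    (∀ (s' : ℝ) (hs' : 0 < s'), emQ x θ₀ ⟨A, ν, s', hs'⟩ ≤ emQ x θ₀ ⟨A, ν, s, hs⟩) ↔
      s = sigmaSqUpdate x θ₀ A (tucker A ν) := by
  rw [sigmaSqUpdate_eq, ← forall_log_add_div_le_iff (dim_pos hn) _ hs]
  exact forall₂_congr fun s' hs' => emQ_le_iff hN x θ₀ _ _

/-- Forwards, an arbitrary `θ'` is compared with `θ` in two moves that do not decrease `Q`: replace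
`(A', ν')` by `(A, ν)` at the old `σ'²`, then `σ'²` by `σ²`. Backwards, a joint maximizer remains
one when some of its coordinates are frozen. -/
theorem isProcedureStep_iff_isEMStep {N : ℕ} (hn : ∀ k, 0 < n k) (hN : 0 < N)
    (x : Fin N → Tensor n) (θ₀ θ : Params n m) :
    IsProcedureStep x θ₀ θ ↔ IsEMStep x θ₀ θ := by
  constructor
  · rintro ⟨⟨ν, hν⟩, hreg, hsing, hσ⟩ θ'
    -- The `ν` witnessing that `A` is optimal need not be `θ.nu`; but `θ.nu` is a minimizer for this
    -- `A`, hence does at least as well.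
    have hmin : ∀ ν', mObjective x θ₀ θ.A (tucker θ.A θ.nu) ≤
        mObjective x θ₀ θ.A (tucker θ.A ν') := by
      by_cases hA : IsUnit (gram θ.A)
      · exact (forall_mObjective_le_iff hN x θ₀ hA _).2 (hreg hA)
      · exact hsing hA
    have h1 : emQ x θ₀ θ' ≤ emQ x θ₀ ⟨θ.A, θ.nu, θ'.sigmaSq, θ'.sigmaSq_pos⟩ :=
      (emQ_le_iff_mObjective_le hN x θ₀ θ'.sigmaSq_pos θ.A θ'.A θ.nu θ'.nu).2
        ((hmin ν).trans (hν _ _))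
    exact h1.trans ((forall_emQ_le_iff_sigmaSq hn hN x θ₀ θ.sigmaSq_pos θ.A θ.nu).2 hσ _ _)
  · intro h
    have hmin : ∀ (A' : Factors n m) (ν' : Tensor m),
        mObjective x θ₀ θ.A (tucker θ.A θ.nu) ≤ mObjective x θ₀ A' (tucker A' ν') :=
      fun A' ν' => (emQ_le_iff_mObjective_le hN x θ₀ θ.sigmaSq_pos θ.A A' θ.nu ν').1 (h _)
    exact ⟨⟨θ.nu, hmin⟩,
      fun hA => (forall_mObjective_le_iff hN x θ₀ hA _).1 (hmin θ.A),
      fun _ => hmin θ.A,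
      (forall_emQ_le_iff_sigmaSq hn hN x θ₀ θ.sigmaSq_pos θ.A θ.nu).1 fun _ _ => h _⟩

/-! ### The E-step -/

section Sample

variable {Ω : Type*} [MeasurableSpace Ω] {P : Measure Ω} [IsProbabilityMeasure P]
  {θ₀ : Params n m}

theorem IsTPCA.integrable_residual {X : Ω → Tensor n} {Z : Ω → Tensor m}
    (h : IsTPCA P θ₀ X Z) : Integrable (fun ω => Z ω - eMean θ₀ (X ω)) P :=
  (memLp_of_forall_inner h.memLp_inner_residual).integrable one_le_two

theorem IsTPCA.integral_residual {X : Ω → Tensor n} {Z : Ω → Tensor m}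
    (h : IsTPCA P θ₀ X Z) : ∫ ω, (Z ω - eMean θ₀ (X ω)) ∂P = 0 := by
  have h1 := integral_residualLaw θ₀
  rwa [← h.map_residual, integral_map h.measurable_residual.aemeasurable (by fun_prop)] at h1

/-- `Z = E(X) + W`, where `E(X)` is a function of `X` and `W` is independent of `X` with mean zero.
-/
theorem IsTPCA.condExp_latent {X : Ω → Tensor n} {Z : Ω → Tensor m} (h : IsTPCA P θ₀ X Z) :
    P[Z | MeasurableSpace.comap X inferInstance] =ᵐ[P] fun ω => eMean θ₀ (X ω) := by
  have hX := h.measurable_obs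
  have hW := h.measurable_residual
  have hEi : Integrable (fun ω => eMean θ₀ (X ω)) P := by
    have := (h.memLp_latent.integrable one_le_two).sub h.integrable_residual
    refine this.congr (ae_of_all _ fun ω => ?_)
    simp
  have hEm : StronglyMeasurable[MeasurableSpace.comap X inferInstance]
      (fun ω => eMean θ₀ (X ω)) :=
    ((continuous_eMean θ₀).measurable.comp (comap_measurable X)).stronglyMeasurable
  have e : Z = (fun ω => eMean θ₀ (X ω)) + fun ω => Z ω - eMean θ₀ (X ω) := by
    funext ω; simp
  have h1 := condExp_add (μ := P) hEi h.integrable_residual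
    (MeasurableSpace.comap X inferInstance)
  have h2 := condExp_of_stronglyMeasurable hX.comap_le hEm hEi
  have h3 := condExp_indep_eq hW.comap_le hX.comap_le
    (comap_measurable (fun ω => Z ω - eMean θ₀ (X ω))).stronglyMeasurable
    h.indepFun_residual.symm
  rw [← e] at h1
  filter_upwards [h1, h3] with ω e1 e3
  rw [e1, Pi.add_apply, e3, h2, h.integral_residual, add_zero]

/-- The centred variable is the residual, which is independent of `X`; so its conditional second
moments are the constant unconditional ones. -/
theorem IsTPCA.condExp_cov_latent {X : Ω → Tensor n} {Z : Ω → Tensor m}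
    (h : IsTPCA P θ₀ X Z) (S T : Tensor m) :
    P[fun ω =>
        inner ℝ (Z ω - (P[Z | MeasurableSpace.comap X inferInstance]) ω) S *
        inner ℝ (Z ω - (P[Z | MeasurableSpace.comap X inferInstance]) ω) T
      | MeasurableSpace.comap X inferInstance] =ᵐ[P] fun _ => inner ℝ (eCov θ₀ S) T := by
  have hX := h.measurable_obs
  have hW := h.measurable_residual
  have hm := comap_measurable (m := inferInstance) (fun ω => Z ω - eMean θ₀ (X ω))
  have hφ : Measurable fun w : Tensor m => inner ℝ w S * inner ℝ w T := by fun_prop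
  have h1 := condExp_indep_eq hW.comap_le hX.comap_le
    (hφ.comp hm).stronglyMeasurable h.indepFun_residual.symm
  refine (condExp_congr_ae ?_).trans (h1.trans (ae_of_all _ fun ω => ?_))
  · filter_upwards [h.condExp_latent] with ω e
    rw [e]
    rfl
  · exact h.integral_inner_residual_mul S T

theorem IsTPCA.integrable_log_jointDensity {X : Ω → Tensor n} {Z : Ω → Tensor m}
    (h : IsTPCA P θ₀ X Z) (θ : Params n m) :
    Integrable (fun ω => Real.log (jointDensity θ (X ω) (Z ω))) P := by
  simp only [log_jointDensity]
  have i1 := h.memLp_latent.norm.integrable_sq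
  have i2 := ((h.memLp_obs.sub (memLp_const θ.mu)).sub
    ((LinearMap.toContinuousLinearMap (tucker θ.A)).comp_memLp' h.memLp_latent)).norm.integrable_sq
  exact ((integrable_const _).sub (i1.const_mul _)).sub (i2.const_mul _)

variable {N : ℕ} {X : Fin N → Ω → Tensor n} {Z : Fin N → Ω → Tensor m}

/-- The residual of one draw is independent of all the observed tensors. -/
theorem IsTPCASample.indepFun_residual (h : IsTPCASample P θ₀ X Z) (i : Fin N) :
    IndepFun (fun ω j => X j ω) (fun ω => Z i ω - eMean θ₀ (X i ω)) P := by
  have hE := (continuous_eMean θ₀).measurable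
  refine indepFun_pi_of_iIndepFun_prodMk (W := fun i ω => Z i ω - eMean θ₀ (X i ω))
    (fun j => (h.1 j).measurable_obs) (fun j => (h.1 j).measurable_residual) ?_ i
    (h.1 i).indepFun_residual
  exact h.2.comp (fun _ p => (p.1, p.2 - eMean θ₀ p.1)) fun _ => by fun_prop

/-- With `Z i = W i + E(X i)`, the integrand is a function of the whole sample `X` and of `W i`,
which are independent. Conditioning integrates out `W i` against the residual law, and translating
by `E(X i)` turns this into the posterior integral. -/
theorem IsTPCASample.condExp_log_jointDensity (h : IsTPCASample P θ₀ X Z) (θ : Params n m)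
    (i : Fin N) :
    P[fun ω => Real.log (jointDensity θ (X i ω) (Z i ω))
      | MeasurableSpace.comap (fun ω i => X i ω) inferInstance] =ᵐ[P]
      fun ω => ∫ z, Real.log (jointDensity θ (X i ω) z) ∂(latentPosterior θ₀ (X i ω)) := by
  have hE := (continuous_eMean θ₀).measurable
  have hF := (continuous_tucker θ.A).measurable
  have hX : Measurable fun ω j => X j ω := measurable_pi_lambda _ fun j => (h.1 j).measurable_obs
  have hi := (h.1 i).integrable_log_jointDensity θ
  have hf : Measurable fun p : (Fin N → Tensor n) × Tensor m =>
      Real.log (jointDensity θ (p.1 i) (p.2 + eMean θ₀ (p.1 i))) := by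
    simp only [log_jointDensity]
    fun_prop
  have key := condExp_of_indepFun hX (h.1 i).measurable_residual (h.indepFun_residual i) hf
    (by simpa only [sub_add_cancel] using hi)
  simp only [sub_add_cancel, (h.1 i).map_residual] at key
  simpa only [integral_log_jointDensity_eq_residualLaw] using key

theorem IsTPCASample.integrable_logLik (h : IsTPCASample P θ₀ X Z) (θ : Params n m) :
    Integrable (fun ω => logLik θ (fun i => X i ω) (fun i => Z i ω)) P :=
  integrable_finsetSum _ fun i _ => (h.1 i).integrable_log_jointDensity θ

theorem IsTPCASample.condExp_logLik (h : IsTPCASample P θ₀ X Z) (θ : Params n m) :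
    P[fun ω => logLik θ (fun i => X i ω) (fun i => Z i ω)
      | MeasurableSpace.comap (fun ω i => X i ω) inferInstance] =ᵐ[P]
      fun ω => emQ (fun i => X i ω) θ₀ θ := by
  have h1 := condExp_finsetSum (μ := P) (s := Finset.univ)
    (f := fun i ω => Real.log (jointDensity θ (X i ω) (Z i ω)))
    (fun i _ => (h.1 i).integrable_log_jointDensity θ)
    (MeasurableSpace.comap (fun ω i => X i ω) inferInstance)
  have h2 := ae_all_iff.2 fun i => h.condExp_log_jointDensity θ i
  have e : (fun ω => logLik θ (fun i => X i ω) (fun i => Z i ω)) =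
      ∑ i, fun ω => Real.log (jointDensity θ (X i ω) (Z i ω)) := by
    funext ω; simp [logLik]
  rw [e]
  filter_upwards [h1, h2] with ω e1 e2
  rw [e1, Finset.sum_apply, emQ]
  exact Finset.sum_congr rfl fun i _ => e2 i

end Sample

end

end TPCA

theorem mainTheorem7 {r : ℕ} {n m : Fin r → ℕ} (hn : ∀ k, 0 < n k) {N : ℕ} (hN : 0 < N) :
    -- E-step: complete-data law, conditional mean and covariance, and the EM objective
    (∀ (Ω : Type*) [MeasurableSpace Ω] (P : Measure Ω) [IsProbabilityMeasure P]
        (θ₀ : Params n m) (X : Fin N → Ω → Tensor n) (Z : Fin N → Ω → Tensor m),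
      IsTPCASample P θ₀ X Z →
      (∀ i, P.map (fun ω => (X i ω, Z i ω)) =
        ((volume : Measure (Tensor n)).prod (volume : Measure (Tensor m))).withDensity
          fun p => ENNReal.ofReal (jointDensity θ₀ p.1 p.2)) ∧
      (∀ i, Integrable (Z i) P ∧
        P[Z i | MeasurableSpace.comap (X i) inferInstance] =ᵐ[P]
          fun ω => eMean θ₀ (X i ω)) ∧
      (∀ i (S T : Tensor m),
        P[fun ω =>
            inner ℝ (Z i ω - (P[Z i | MeasurableSpace.comap (X i) inferInstance]) ω) S *
            inner ℝ (Z i ω - (P[Z i | MeasurableSpace.comap (X i) inferInstance]) ω) T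
          | MeasurableSpace.comap (X i) inferInstance] =ᵐ[P]
          fun _ => inner ℝ (eCov θ₀ S) T) ∧
      (∀ θ : Params n m,
        Integrable (fun ω => logLik θ (fun i => X i ω) (fun i => Z i ω)) P ∧
        P[fun ω => logLik θ (fun i => X i ω) (fun i => Z i ω)
          | MeasurableSpace.comap (fun ω i => X i ω) inferInstance] =ᵐ[P]
          fun ω => emQ (fun i => X i ω) θ₀ θ)) ∧
    -- For every data set and every current parameter
    (∀ (x : Fin N → Tensor n) (θ₀ : Params n m),
      IsUnit (opM θ₀) ∧
      -- mean and covariance of the conditional law of the latent tensor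
      (∀ i, IsProbabilityMeasure (latentPosterior θ₀ (x i)) ∧
        Integrable (fun z => z) (latentPosterior θ₀ (x i)) ∧
        ∫ z, z ∂(latentPosterior θ₀ (x i)) = eMean θ₀ (x i) ∧
        ∀ S T : Tensor m,
          ∫ z, inner ℝ (z - eMean θ₀ (x i)) S * inner ℝ (z - eMean θ₀ (x i)) T
            ∂(latentPosterior θ₀ (x i)) = inner ℝ (eCov θ₀ S) T) ∧
      -- the expected complete-data log-likelihood
      (∀ θ : Params n m,
        (∀ i, Integrable (fun z => Real.log (jointDensity θ (x i) z)) (latentPosterior θ₀ (x i))) ∧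
        emQ x θ₀ θ =
          -(N * (dim n + dim m) / 2 * Real.log (2 * Real.pi))
          - 1 / 2 * ∑ i, ‖eMean θ₀ (x i)‖ ^ 2
          - dim n * N / 2 * Real.log θ.sigmaSq
          - 1 / (2 * θ.sigmaSq) * rss x (fun i => eMean θ₀ (x i)) θ.A θ.mu
          - N / 2 * LinearMap.trace ℝ (Tensor m) (eCov θ₀)
          - N / (2 * θ.sigmaSq) * traceTerm (eCov θ₀) θ.A) ∧
      -- increasing it in `(A, ν)` is the same as decreasing the M-step objective
      (∀ (s : ℝ) (hs : 0 < s) (A A' : Factors n m) (ν ν' : Tensor m),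
        emQ x θ₀ ⟨A', ν', s, hs⟩ ≤ emQ x θ₀ ⟨A, ν, s, hs⟩ ↔
          mObjective x θ₀ A (tucker A ν) ≤ mObjective x θ₀ A' (tucker A' ν')) ∧
      -- the update of `ν` is the unique maximizer in `ν`
      (∀ (s : ℝ) (hs : 0 < s) (A : Factors n m) (ν : Tensor m), IsUnit (gram A) →
        ((∀ ν' : Tensor m, emQ x θ₀ ⟨A, ν', s, hs⟩ ≤ emQ x θ₀ ⟨A, ν, s, hs⟩) ↔
          ν = nuUpdate x θ₀ A)) ∧
      -- the update of `σ²` is the unique maximizer in `σ²`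
      (∀ (s : ℝ) (hs : 0 < s) (A : Factors n m) (ν : Tensor m),
        (∀ (s' : ℝ) (hs' : 0 < s'), emQ x θ₀ ⟨A, ν, s', hs'⟩ ≤ emQ x θ₀ ⟨A, ν, s, hs⟩) ↔
          s = sigmaSqUpdate x θ₀ A (tucker A ν)) ∧
      -- one round of the procedure is one EM step
      (∀ θ : Params n m, IsProcedureStep x θ₀ θ ↔ IsEMStep x θ₀ θ)) ∧
    -- the runs of the procedure are the runs of the EM algorithm
    (∀ (x : Fin N → Tensor n) (θ : ℕ → Params n m),
      (∀ t, IsProcedureStep x (θ t) (θ (t + 1))) ↔ (∀ t, IsEMStep x (θ t) (θ (t + 1)))) := by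
  refine ⟨fun Ω _ P _ θ₀ X Z h => ⟨fun i => (h.1 i).map_prod,
    fun i => ⟨(h.1 i).memLp_latent.integrable one_le_two, (h.1 i).condExp_latent⟩,
    fun i S T => (h.1 i).condExp_cov_latent S T,
    fun θ => ⟨h.integrable_logLik θ, h.condExp_logLik θ⟩⟩,
    fun x θ₀ => ⟨isUnit_opM θ₀,
      fun i => ⟨isProbabilityMeasure_latentPosterior θ₀ _, integrable_latentPosterior θ₀ _,
        integral_latentPosterior θ₀ _, integral_inner_mul_latentPosterior θ₀ _⟩,
      fun θ => ⟨fun i => integrable_log_jointDensity θ₀ θ _, emQ_eq x θ₀ θ⟩,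
      fun s hs A A' ν ν' => emQ_le_iff_mObjective_le hN x θ₀ hs A A' ν ν',
      fun s hs A ν hA => ?_,
      fun s hs A ν => forall_emQ_le_iff_sigmaSq hn hN x θ₀ hs A ν,
      isProcedureStep_iff_isEMStep hn hN x θ₀⟩,
    fun x θ => forall_congr' fun t => isProcedureStep_iff_isEMStep hn hN x _ _⟩
  rw [← forall_mObjective_le_iff hN x θ₀ hA]
  exact forall_congr' fun ν' => emQ_le_iff_mObjective_le hN x θ₀ hs A A ν ν'
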